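/- Let $K=\frac{1}{1+i}\begin{pmatrix}1&1\\1&-1\end{pmatrix}$, $S=\mathrm{diag}(1,i)$, $\mathrm{CS}=\mathrm{diag}(1,1,1,i)$. Acting on three qubits $0,1,2$, let $i$ denote the scalar $iI$, let $K_j,S_j$ be $K,S$ applied to qubit $j$, and $\mathrm{CS}_{01}=\mathrm{CS}\otimes I$, $\mathrm{CS}_{12}=I\otimes\mathrm{CS}$. The 3-qubit Clifford+CS group is the group of $8\times 8$ unitary matrices generated by $i,K_0,K_1,K_2,S_0,S_1,S_2,\mathrm{CS}_{01},\mathrm{CS}_{12}$. Define the following elements (the target of a controlled gate is the last index; products are matrix products): $X_j=K_jS_jS_jK_j\,i$ (Pauli $X$); $\mathrm{CX}_{01}=K_1\mathrm{CS}_{01}^2K_1\,i$, $\mathrm{CX}_{10}=K_0\mathrm{CS}_{01}^2K_0\,i$, $\mathrm{CX}_{12}=K_2\mathrm{CS}_{12}^2K_2\,i$, $\mathrm{CX}_{21}=K_1\mathrm{CS}_{12}^2K_1\,i$ (controlled $X$); $\mathrm{Swap}_{12}=\mathrm{CX}_{12}\mathrm{CX}_{21}\mathrm{CX}_{12}$,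 $\mathrm{CS}_{02}=\mathrm{Swap}_{12}\mathrm{CS}_{01}\mathrm{Swap}_{12}$, $\mathrm{CX}_{20}=K_0\mathrm{CS}_{02}^2K_0\,i$; $\mathrm{CK}_{10}=\mathrm{CS}_{01}K_0\mathrm{CS}_{01}K_0S_1^3\mathrm{CS}_{01}\,i$, $\mathrm{CK}_{20}=\mathrm{Swap}_{12}\mathrm{CK}_{10}\mathrm{Swap}_{12}$ (controlled $K$); $\mathrm{CCZ}=\mathrm{CS}_{01}\mathrm{CX}_{21}\mathrm{CS}_{01}^3\mathrm{CX}_{21}\mathrm{CS}_{02}$, $\mathrm{CCX}_0=K_0\,\mathrm{CCZ}\,K_0\,i$ (doubly controlled $Z$ and $X$); $\mathrm{CCK}'_0=K_0\mathrm{CS}_{01}K_0\mathrm{CS}_{02}K_0\mathrm{CS}_{01}K_0\mathrm{CCX}_0\mathrm{CX}_{10}\mathrm{CS}_{12}^3\mathrm{CS}_{02}^3\,i^2$ (doubly controlled $K'=KS^\dagger$ with target qubit $0$). Let $\mathcal X_Q=\{X_0,\mathrm{CX}_{10},\mathrm{CX}_{20},\mathrm{CCX}_0\}$, $\mathcal X_C=\{X_1,\mathrm{CX}_{12},\mathrm{CX}_{21}\}$,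 $\mathcal X_P=\{\mathrm{CX}_{01},\mathrm{CX}_{10},\mathrm{CX}_{12},\mathrm{CX}_{21},\mathrm{CCX}_0,X_0\}$, $\mathcal X_D=\{i,S_0,S_1,S_2,\mathrm{CS}_{01},\mathrm{CS}_{12},\mathrm{CS}_{02},\mathrm{CCZ}\}$. Let $Q,C,P,D$ be the subgroups generated by $\mathcal X_Q,\mathcal X_C,\mathcal X_P,\mathcal X_D$ respectively; let $CQ,PD,QD$ be the subgroups generated by $\mathcal X_C\cup\mathcal X_Q$, $\mathcal X_P\cup\mathcal X_D$, $\mathcal X_Q\cup\mathcal X_D$; and let $K_0D$ and $K_0CD$ be the subgroups generated by $\{K_0\}\cup\mathcal X_D$ and $\{K_0\}\cup\mathcal X_C\cup\mathcal X_D$. Theorem. All nine groups $Q,C,CQ,P,D,PD,QD,K_0D,K_0CD$ are finite subgroups of the 3-qubit Clifford+CS group, and they have the following normal forms. (A family of expressions is a normal form for a group $H$ if each expression denotes an element of $H$ and each element of $H$ is denoted by exactly one choice of the parameters of the expression; $\overline H$ denotes an expression of the normal form of $H$.) 1. $\overline Q=X_0^a\,\mathrm{CX}_{10}^b\,\mathrm{CX}_{20}^c\,\mathrm{CCX}_0^d$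 with $a,b,c,d\in\{0,1\}$; so $|Q|=16$. 2. $\overline C=c_4c_3c_2$ with $c_2\in\{\epsilon,\mathrm{CX}_{12}\}$, $c_3\in\{\epsilon,\mathrm{CX}_{21},\mathrm{CX}_{12}\mathrm{CX}_{21}\}$, $c_4\in\{X_1^aX_2^b\mid a,b\in\{0,1\}\}$; so $|C|=24$. 3. $CQ$ is the semidirect product of $C$ and $Q$ with $Q$ normal, and $\overline{CQ}=\overline C\,\overline Q$. 4. $CQ$ is a subgroup of $P$ with exactly $105$ left cosets, and for every set $V$ of representatives of these left cosets (such $V$ exist and have $105$ elements) $\overline P=c\,\overline{CQ}$ with $c\in V$. 5. $\overline D=i^{n_0}S_0^{n_1}S_1^{n_2}S_2^{n_3}\mathrm{CS}_{01}^{n_4}\mathrm{CS}_{12}^{n_5}\mathrm{CS}_{02}^{n_6}\mathrm{CCZ}^{n_7}$ with $n_0,\ldots,n_6\in\{0,1,2,3\}$ and $n_7\in\{0,1\}$. 6. $PD$ is the semidirect product of $P$ and $D$ with $D$ normal, and $\overline{PD}=\overline P\,\overline D$ (for every $V$ as in 4). 7. $QD$ is the semidirect product of $Q$ and $D$ with $D$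 normal, and $\overline{QD}=\overline Q\,\overline D$. 8. $Q\subseteq K_0D$, and $\overline{K_0D}=e_4e_3e_2e_1\,\overline D\,\overline Q$ with $e_1\in\{\epsilon,\mathrm{CCK}'_0,\mathrm{CCK}'_0\mathrm{CCK}'_0\}$, $e_2\in\{\epsilon,\mathrm{CK}_{10},S_0\mathrm{CK}_{10}\}$, $e_3\in\{\epsilon,\mathrm{CK}_{20},S_0\mathrm{CK}_{20}\}$, $e_4\in\{\epsilon,K_0,S_0K_0\}$. 9. $Q\subseteq K_0CD$, and $\overline{K_0CD}=\overline{K_0D}\,\overline C=e_4e_3e_2e_1\,\overline D\,\overline Q\,\overline C$ with $e_1,\ldots,e_4$ as in 8. In particular $K_0CD$ is finite. -/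

import Mathlib

open scoped Kronecker

noncomputable section

namespace CliffordCS

/-! ### Three-qubit unitaries -/

/-- Labels of the computational basis vectors of three qubits; the components are the values of
qubits 0, 1 and 2, in this order. -/
abbrev Basis3 : Type := Fin 2 × Fin 2 × Fin 2

/-- The group of `8 × 8` unitary matrices. -/
abbrev U8 : Type := Matrix.unitaryGroup Basis3 ℂ

/-- The tensor (Kronecker) product of two unitaries. -/
def tensor {m n : Type} [Fintype m] [DecidableEq m] [Fintype n] [DecidableEq n]
    (A : Matrix.unitaryGroup m ℂ) (B : Matrix.unitaryGroup n ℂ) :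
    Matrix.unitaryGroup (m × n) ℂ :=
  ⟨A.1 ⊗ₖ B.1, Matrix.kronecker_mem_unitary A.2 B.2⟩

/-- Renaming the index set of a unitary along a bijection. -/
def relabel {m n : Type} [Fintype m] [DecidableEq m] [Fintype n] [DecidableEq n]
    (e : m ≃ n) (A : Matrix.unitaryGroup m ℂ) : Matrix.unitaryGroup n ℂ :=
  ⟨Matrix.reindex e e A.1, by
    have h := Matrix.mem_unitaryGroup_iff.mp A.2
    rw [Matrix.mem_unitaryGroup_iff]
    have h2 : (Matrix.reindex e e A.1) * star (Matrix.reindex e e A.1)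
        = Matrix.reindex e e (A.1 * star A.1) := by
      simp [Matrix.star_eq_conjTranspose, Matrix.conjTranspose_submatrix,
        Matrix.submatrix_mul_equiv]
    rw [h2, h]
    simp⟩

/-- `K = (1 + i)⁻¹ (1 1; 1 -1)`. -/
def K : Matrix.unitaryGroup (Fin 2) ℂ :=
  ⟨(1 / (1 + Complex.I)) • !![1, 1; 1, -1], by
    have h2 : (1 / (1 + Complex.I)) * (starRingEnd ℂ) (1 / (1 + Complex.I)) = 1 / 2 := by
      rw [Complex.mul_conj, Complex.normSq_div]
      simp [Complex.normSq_apply]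
      norm_num
    rw [Matrix.mem_unitaryGroup_iff, Matrix.star_eq_conjTranspose, Matrix.conjTranspose_smul,
      Matrix.smul_mul, Matrix.mul_smul, smul_smul]
    have h3 : (1 / (1 + Complex.I)) * star (1 / (1 + Complex.I)) = 1 / 2 := h2
    rw [h3]
    ext a b
    fin_cases a <;> fin_cases b <;>
      simp [Matrix.mul_apply, Matrix.conjTranspose_apply, Fin.sum_univ_two,
        -Matrix.cons_mul] <;> norm_num⟩

/-- A diagonal matrix whose entries have modulus one. -/
def diagU {m : Type} [Fintype m] [DecidableEq m] (d : m → ℂ) (hd : ∀ j, d j * star (d j) = 1) :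
    Matrix.unitaryGroup m ℂ :=
  ⟨Matrix.diagonal d, by
    rw [Matrix.mem_unitaryGroup_iff, Matrix.star_eq_conjTranspose,
      Matrix.diagonal_conjTranspose, Matrix.diagonal_mul_diagonal, ← Matrix.diagonal_one]
    congr 1
    funext j
    exact hd j⟩

/-- The phase gate `S = diag(1, i)`. -/
def S : Matrix.unitaryGroup (Fin 2) ℂ :=
  diagU (fun j => if j = 1 then Complex.I else 1) (by intro j; split_ifs <;> simp)

/-- The controlled phase gate `CS = diag(1, 1, 1, i)`. -/
def CS : Matrix.unitaryGroup (Fin 2 × Fin 2) ℂ :=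
  diagU (fun j => if j = (1, 1) then Complex.I else 1) (by intro j; split_ifs <;> simp)

/-! ### The generators of the three-qubit Clifford+CS group -/

/-- The scalar `i`, identified with the matrix `i I`. -/
def iG : U8 := diagU (fun _ => Complex.I) (by intro j; simp)

def K0 : U8 := tensor K (tensor 1 1)
def K1 : U8 := tensor 1 (tensor K 1)
def K2 : U8 := tensor 1 (tensor 1 K)
def S0 : U8 := tensor S (tensor 1 1)
def S1 : U8 := tensor 1 (tensor S 1)
def S2 : U8 := tensor 1 (tensor 1 S)

/-- `CS ⊗ I`. -/
def CS01 : U8 := relabel (Equiv.prodAssoc (Fin 2) (Fin 2) (Fin 2)) (tensor CS 1)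

/-- `I ⊗ CS`. -/
def CS12 : U8 := tensor 1 CS

/-- The three-qubit Clifford+CS group. -/
def CliffordCS3 : Subgroup U8 :=
  Subgroup.closure {iG, K0, K1, K2, S0, S1, S2, CS01, CS12}

/-! ### Derived gates, given by their defining circuits

Circuits are written in the order of matrix multiplication. In the notation for controlled gates
the target is the last index. -/

def X0 : U8 := K0 * S0 * S0 * K0 * iG
def X1 : U8 := K1 * S1 * S1 * K1 * iG
def X2 : U8 := K2 * S2 * S2 * K2 * iG

def CX01 : U8 := K1 * CS01 * CS01 * K1 * iG
def CX10 : U8 := K0 * CS01 * CS01 * K0 * iG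
def CX12 : U8 := K2 * CS12 * CS12 * K2 * iG
def CX21 : U8 := K1 * CS12 * CS12 * K1 * iG

def Swap01 : U8 := CX01 * CX10 * CX01
def Swap12 : U8 := CX12 * CX21 * CX12

def CS02 : U8 := Swap12 * CS01 * Swap12
def CX20 : U8 := K0 * CS02 * CS02 * K0 * iG

/-- Controlled `K`, control qubit 1, target qubit 0. -/
def CK10 : U8 := CS01 * K0 * CS01 * (K0 * S1 ^ 3) * CS01 * iG

/-- Controlled `K`, control qubit 2, target qubit 0. -/
def CK20 : U8 := Swap12 * CK10 * Swap12

def CCZ : U8 := CS01 * CX21 * CS01 * CS01 * CS01 * CX21 * CS02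

/-- The Toffoli gate with target qubit 0. -/
def CCX0 : U8 := K0 * CCZ * K0 * iG

def CZ12 : U8 := CS12 * CS12
def CZ02 : U8 := CS02 * CS02

/-- The doubly controlled `K' = K S†` gate with target qubit 0. -/
def CCK0 : U8 :=
  K0 * CS01 * K0 * CS02 * K0 * CS01 * K0 * CCX0 * CX10 * CS12 * CZ12 * CS02 * CZ02 * iG ^ 2

/-! ### The subgroups -/

def genQ : Set U8 := {X0, CX10, CX20, CCX0}
def genC : Set U8 := {X1, CX12, CX21}
def genP : Set U8 := {CX01, CX10, CX12, CX21, CCX0, X0}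
def genD : Set U8 := {iG, S0, S1, S2, CS01, CS12, CS02, CCZ}

def Q : Subgroup U8 := Subgroup.closure genQ
def C : Subgroup U8 := Subgroup.closure genC
def CQ : Subgroup U8 := Subgroup.closure (genC ∪ genQ)
def P : Subgroup U8 := Subgroup.closure genP
def D : Subgroup U8 := Subgroup.closure genD
def PD : Subgroup U8 := Subgroup.closure (genP ∪ genD)
def QD : Subgroup U8 := Subgroup.closure (genQ ∪ genD)
def K0D : Subgroup U8 := Subgroup.closure ({K0} ∪ genD)
def K0CD : Subgroup U8 := Subgroup.closure ({K0} ∪ genC ∪ genD)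

/-! ### Normal forms -/

/-- The expressions `f p`, for `p` ranging over the parameter set `ι`, are normal forms for `H`:
they all denote elements of `H`, and every element of `H` is denoted by exactly one of them. -/
def IsNormalForm {ι G : Type*} [Group G] (f : ι → G) (H : Subgroup G) : Prop :=
  (∀ p, f p ∈ H) ∧ ∀ g ∈ H, ∃! p, f p = g

/-- The group `A` is the (internal) semidirect product of its subgroups `H` and `N`, with `N` normal. -/
def IsSemidirect {G : Type*} [Group G] (A H N : Subgroup G) : Prop :=
  H ≤ A ∧ N ≤ A ∧ (N.subgroupOf A).Normal ∧ H ⊓ N = ⊥ ∧ H ⊔ N = A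

/-- `V` is a set of representatives for the left cosets of `H` in `A`. -/
def IsLeftCosetReps {G : Type*} [Group G] (V : Set G) (A H : Subgroup G) : Prop :=
  V ⊆ A ∧ ∀ g ∈ A, ∃! c, c ∈ V ∧ c⁻¹ * g ∈ H

abbrev IdxQ : Type := Fin 2 × Fin 2 × Fin 2 × Fin 2

/-- `X₀^a CX₁₀^b CX₂₀^c CCX₀^d`. -/
def nfQ : IdxQ → U8
  | (a, b, c, d) => X0 ^ (a : ℕ) * CX10 ^ (b : ℕ) * CX20 ^ (c : ℕ) * CCX0 ^ (d : ℕ)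

abbrev IdxC : Type := (Fin 2 × Fin 2) × Fin 3 × Fin 2

/-- `c₄ c₃ c₂` with `c₄ ∈ {X₁^a X₂^b}`, `c₃ ∈ {ε, CX₂₁, CX₁₂ CX₂₁}`, `c₂ ∈ {ε, CX₁₂}`. -/
def nfC : IdxC → U8
  | ((a, b), s, t) =>
    (X1 ^ (a : ℕ) * X2 ^ (b : ℕ)) * (![1, CX21, CX12 * CX21] : Fin 3 → U8) s *
      (![1, CX12] : Fin 2 → U8) t

def nfCQ (p : IdxC × IdxQ) : U8 := nfC p.1 * nfQ p.2

/-- Normal forms for `P` with respect to a set `V` of coset representatives. -/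
def nfP (V : Set U8) (p : V × (IdxC × IdxQ)) : U8 := p.1 * nfCQ p.2

abbrev IdxD : Type := Fin 4 × Fin 4 × Fin 4 × Fin 4 × Fin 4 × Fin 4 × Fin 4 × Fin 2

/-- `i^n₀ S₀^n₁ S₁^n₂ S₂^n₃ CS₀₁^n₄ CS₁₂^n₅ CS₀₂^n₆ CCZ^n₇`. -/
def nfD : IdxD → U8
  | (n0, n1, n2, n3, n4, n5, n6, n7) =>
    iG ^ (n0 : ℕ) * S0 ^ (n1 : ℕ) * S1 ^ (n2 : ℕ) * S2 ^ (n3 : ℕ) * CS01 ^ (n4 : ℕ) *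
      CS12 ^ (n5 : ℕ) * CS02 ^ (n6 : ℕ) * CCZ ^ (n7 : ℕ)

def nfPD (V : Set U8) (p : (V × (IdxC × IdxQ)) × IdxD) : U8 := nfP V p.1 * nfD p.2

def nfQD (p : IdxQ × IdxD) : U8 := nfQ p.1 * nfD p.2

abbrev IdxE : Type := Fin 3 × Fin 3 × Fin 3 × Fin 3

def e1 : Fin 3 → U8 := ![1, CCK0, CCK0 * CCK0]
def e2 : Fin 3 → U8 := ![1, CK10, S0 * CK10]
def e3 : Fin 3 → U8 := ![1, CK20, S0 * CK20]
def e4 : Fin 3 → U8 := ![1, K0, S0 * K0]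

/-- `e₄ e₃ e₂ e₁`. -/
def nfE : IdxE → U8
  | (a4, a3, a2, a1) => e4 a4 * e3 a3 * e2 a2 * e1 a1

def nfK0D (p : IdxE × IdxD × IdxQ) : U8 := nfE p.1 * nfD p.2.1 * nfQ p.2.2

def nfK0CD (p : (IdxE × IdxD × IdxQ) × IdxC) : U8 := nfK0D p.1 * nfC p.2

end CliffordCS

end

/-!
Each gate is a permutation matrix (`permU`), a diagonal matrix of powers of `i` (`phaseU`) or a
block diagonal matrix with `2 × 2` blocks indexed by the values of two control qubits (`blockU`).
These three constructions are injective homomorphisms, and through them every group becomes a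
transparent one.

* `P` is the group of all permutations of the eight basis labels, because its generators contain a
  transposition of two labels that are adjacent on an `8`-cycle (`closure_permGenP`). Inside it, `Q`
  flips qubit `0` depending on the other two qubits, `C` permutes the four values of qubits `1` and
  `2`, and `CQ` is the semidirect product of the two, of order `24 * 16 = 8! / 105`.
* `D` consists of the diagonal matrices `diag (i ^ d j)` with `∑ j, d j` even (`D_eq_map`): the
  exponents in the normal form are the coefficients of `d` as a polynomial in the three bits. The
  parity condition does not depend on the order of the labels, so `P` normalizes `D`.
* `K₀` and the diagonal gates generate block diagonal matrices whose blocks lie in the single-qubit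
  Clifford group and have total determinant `1` or `-1` (`K0D_le_map_blockGroup`). The monomial
  matrices have three cosets in the single-qubit Clifford group, represented by `1`, `K` and `S K`
  (`isNormalForm_clifford1`). The factors `e₄`, `e₃`, `e₂`, `e₁` make the blocks at control values
  `00`, `01`, `10`, `11` monomial in turn (`exists_nfE_inv_mul_mem_QD`), and the same triangular
  shape shows that they are unique (`nfE_eq_of_mul_eq`). What is left over has monomial blocks and
  total determinant `±1`, which means that it lies in `QD` (`blockU_mem_QD`).
* `C` permutes the blocks and normalizes `D`, hence it normalizes `K₀D`, and it meets `K₀D`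
  trivially because a permutation of the blocks that is block diagonal is the identity.

Identities between words in `K`, `S`, `X` and `i` are checked in the Gaussian integers, after
multiplication by a power of `1 + i` (`IsScaled`).
-/

open scoped Kronecker

noncomputable section

namespace CliffordCS

/-! ### Normal forms in abstract groups -/

section Abstract

variable {G G' ι κ : Type*} [Group G] [Group G']

theorem isNormalForm_iff {f : ι → G} {H : Subgroup G} :
    IsNormalForm f H ↔ Function.Injective f ∧ Set.range f = H := by
  constructor
  · rintro ⟨h1, h2⟩
    refine ⟨fun p q hpq => (h2 (f q) (h1 q)).unique hpq rfl, Set.Subset.antisymm ?_ ?_⟩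
    · rintro _ ⟨p, rfl⟩
      exact h1 p
    · intro g hg
      exact (h2 g hg).exists
  · rintro ⟨h1, h2⟩
    refine ⟨fun p => ?_, fun g hg => ?_⟩
    · rw [← SetLike.mem_coe, ← h2]
      exact ⟨p, rfl⟩
    · rw [← SetLike.mem_coe, ← h2] at hg
      obtain ⟨p, rfl⟩ := hg
      exact ⟨p, rfl, fun q hq => h1 hq⟩

theorem IsNormalForm.injective {f : ι → G} {H : Subgroup G} (h : IsNormalForm f H) :
    Function.Injective f :=
  (isNormalForm_iff.1 h).1

theorem IsNormalForm.exists_eq {f : ι → G} {H : Subgroup G} (h : IsNormalForm f H) {g : G}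
    (hg : g ∈ H) : ∃ p, f p = g :=
  (h.2 g hg).exists

theorem IsNormalForm.finite [Finite ι] {f : ι → G} {H : Subgroup G} (h : IsNormalForm f H) :
    Finite H := by
  have := Set.finite_range f
  rw [(isNormalForm_iff.1 h).2] at this
  exact this.to_subtype

theorem IsNormalForm.natCard {f : ι → G} {H : Subgroup G} (h : IsNormalForm f H) :
    Nat.card H = Nat.card ι := by
  have h' := isNormalForm_iff.1 h
  have := Nat.card_range_of_injective h'.1
  rw [h'.2] at this
  exact this

theorem IsNormalForm.inv {f : ι → G} {H : Subgroup G} (h : IsNormalForm f H) :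
    IsNormalForm (fun p => (f p)⁻¹) H := by
  refine ⟨fun p => inv_mem (h.1 p), fun x hx => ?_⟩
  simpa [inv_eq_iff_eq_inv] using h.2 x⁻¹ (inv_mem hx)

theorem IsNormalForm.map {f : ι → G} {H : Subgroup G} (h : IsNormalForm f H) {φ : G →* G'}
    (hφ : Function.Injective φ) : IsNormalForm (fun p => φ (f p)) (H.map φ) := by
  rw [isNormalForm_iff] at h ⊢
  refine ⟨hφ.comp h.1, ?_⟩
  rw [Subgroup.coe_map, ← h.2, ← Set.range_comp]
  rfl

open scoped Pointwise in
/-- A finite family of elements is a normal form for the generated group as soon as its range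
contains `1` and is stable under left multiplication by the generators: the stabilizer of the
range then contains the whole group. -/
theorem isNormalForm_closure [Finite ι] {f : ι → G} {s : Set G} (hf : Function.Injective f)
    (hmem : ∀ p, f p ∈ Subgroup.closure s) (h1 : ∃ p, f p = 1)
    (hs : ∀ g ∈ s, ∀ p, ∃ q, f q = g * f p) : IsNormalForm f (Subgroup.closure s) := by
  rw [isNormalForm_iff]
  refine ⟨hf, Set.Subset.antisymm ?_ ?_⟩
  · rintro _ ⟨p, rfl⟩
    exact hmem p
  intro g hg
  have hsub : Subgroup.closure s ≤ MulAction.stabilizer G (Set.range f) := by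
    rw [Subgroup.closure_le]
    intro a ha
    rw [SetLike.mem_coe, MulAction.mem_stabilizer_set_iff_smul_set_subset (Set.finite_range f)]
    rintro _ ⟨_, ⟨p, rfl⟩, rfl⟩
    obtain ⟨q, hq⟩ := hs a ha p
    exact ⟨q, hq⟩
  have := MulAction.mem_stabilizer_iff.1 (hsub hg)
  rw [← this]
  exact ⟨1, h1, mul_one g⟩

/-- A subgroup normalizes the subgroup generated by `s` if it conjugates `s` into it. -/
theorem conj_mem_closure {H : Subgroup G} {s : Set G}
    (h : ∀ a ∈ H, ∀ b ∈ s, a * b * a⁻¹ ∈ Subgroup.closure s) {a n : G} (ha : a ∈ H)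
    (hn : n ∈ Subgroup.closure s) : a * n * a⁻¹ ∈ Subgroup.closure s := by
  have : Subgroup.closure s ≤ (Subgroup.closure s).comap (MulAut.conj a).toMonoidHom := by
    rw [Subgroup.closure_le]
    intro b hb
    simpa using h a ha b hb
  simpa using this hn

theorem isSemidirect_sup {H N : Subgroup G} (hn : ∀ a ∈ H, ∀ n ∈ N, a * n * a⁻¹ ∈ N)
    (hd : H ⊓ N = ⊥) : IsSemidirect (H ⊔ N) H N := by
  refine ⟨le_sup_left, le_sup_right, ?_, hd, rfl⟩
  rw [Subgroup.normal_subgroupOf_iff_le_normalizer le_sup_right]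
  refine sup_le ?_ Subgroup.le_normalizer
  intro a ha
  rw [Subgroup.mem_normalizer_iff]
  refine fun n => ⟨fun h => hn a ha n h, fun h => ?_⟩
  have := hn a⁻¹ (inv_mem ha) _ h
  simpa [mul_assoc] using this

theorem IsSemidirect.isNormalForm_mul {A H N : Subgroup G} (h : IsSemidirect A H N) {f : ι → G}
    {g : κ → G} (hf : IsNormalForm f H) (hg : IsNormalForm g N) :
    IsNormalForm (fun p : ι × κ => f p.1 * g p.2) A := by
  obtain ⟨hH, hN, hn, hd, rfl⟩ := h
  rw [Subgroup.normal_subgroupOf_iff_le_normalizer hN] at hn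
  rw [isNormalForm_iff] at hf hg ⊢
  constructor
  · rintro ⟨p, q⟩ ⟨p', q'⟩ (hpq : f p * g q = f p' * g q')
    have hmem : (f p')⁻¹ * f p ∈ H ⊓ N := by
      rw [Subgroup.mem_inf]
      refine ⟨mul_mem (inv_mem (hf.2.le ⟨p', rfl⟩)) (hf.2.le ⟨p, rfl⟩), ?_⟩
      have : (f p')⁻¹ * f p = g q' * (g q)⁻¹ := by
        rw [inv_mul_eq_iff_eq_mul, ← mul_assoc, ← hpq, mul_inv_cancel_right]
      rw [this]
      exact mul_mem (hg.2.le ⟨q', rfl⟩) (inv_mem (hg.2.le ⟨q, rfl⟩))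
    rw [hd, Subgroup.mem_bot, inv_mul_eq_one] at hmem
    rw [hmem, mul_right_inj] at hpq
    rw [hf.1 hmem, hg.1 hpq]
  · rw [Subgroup.coe_mul_of_left_le_normalizer_right H N (le_sup_left.trans hn), ← hf.2, ← hg.2]
    ext x
    simp [Set.mem_mul]

/-- The normal form with the factors in the other order, obtained by taking inverses. -/
theorem IsSemidirect.isNormalForm_mul_comm {A H N : Subgroup G} (h : IsSemidirect A H N)
    {f : ι → G} {g : κ → G} (hf : IsNormalForm f H) (hg : IsNormalForm g N) :
    IsNormalForm (fun p : κ × ι => g p.1 * f p.2) A := by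
  have h2 := h.isNormalForm_mul hf.inv hg.inv
  rw [isNormalForm_iff] at h2 ⊢
  constructor
  · rintro ⟨q, p⟩ ⟨q', p'⟩ hpq
    have := @h2.1 (p, q) (p', q') (by
      simpa [← mul_inv_rev] using hpq)
    simp only [Prod.mk.injEq] at this ⊢
    exact this.symm
  · ext x
    rw [SetLike.mem_coe, ← inv_mem_iff, ← SetLike.mem_coe, ← h2.2]
    simp only [Set.mem_range, Prod.exists, ← mul_inv_rev, inv_inj]
    exact exists_comm

/-! ### Coset representatives -/

theorem exists_isLeftCosetReps (A H : Subgroup G) : ∃ V : Set G, IsLeftCosetReps V A H := by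
  refine ⟨Set.range fun x : A ⧸ H.subgroupOf A => (x.out : G), ?_, fun g hg => ?_⟩
  · rintro _ ⟨x, rfl⟩
    exact x.out.2
  · refine ⟨((QuotientGroup.mk ⟨g, hg⟩ : A ⧸ H.subgroupOf A).out : G), ⟨⟨_, rfl⟩, ?_⟩, ?_⟩
    · have := QuotientGroup.eq.1
        (QuotientGroup.out_eq' (QuotientGroup.mk ⟨g, hg⟩ : A ⧸ H.subgroupOf A))
      simpa [Subgroup.mem_subgroupOf] using this
    · rintro _ ⟨⟨x, rfl⟩, hx⟩
      have : (QuotientGroup.mk x.out : A ⧸ H.subgroupOf A) = QuotientGroup.mk ⟨g, hg⟩ := by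
        rw [QuotientGroup.eq, Subgroup.mem_subgroupOf]
        simpa using hx
      rw [← this]
      simp

theorem IsLeftCosetReps.ncard_eq {V : Set G} {A H : Subgroup G} (h : IsLeftCosetReps V A H) :
    V.ncard = H.relIndex A := by
  rw [Subgroup.relIndex, Subgroup.index, ← Nat.card_coe_set_eq]
  refine Nat.card_eq_of_bijective
    (fun v : V => (QuotientGroup.mk ⟨v, h.1 v.2⟩ : A ⧸ H.subgroupOf A)) ⟨?_, ?_⟩
  · intro v w hvw
    have hvw' : (v : G)⁻¹ * w ∈ H := by
      simpa [QuotientGroup.eq, Subgroup.mem_subgroupOf] using hvw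
    exact Subtype.ext ((h.2 w (h.1 w.2)).unique ⟨v.2, hvw'⟩ ⟨w.2, by simp⟩)
  · intro x
    obtain ⟨⟨g, hg⟩, rfl⟩ := QuotientGroup.mk_surjective x
    obtain ⟨c, ⟨hc, hcg⟩, -⟩ := h.2 g hg
    refine ⟨⟨c, hc⟩, ?_⟩
    rw [QuotientGroup.eq, Subgroup.mem_subgroupOf]
    simpa using hcg

theorem IsLeftCosetReps.isNormalForm_mul {V : Set G} {A H : Subgroup G}
    (h : IsLeftCosetReps V A H) (hHA : H ≤ A) {f : ι → G} (hf : IsNormalForm f H) :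
    IsNormalForm (fun p : V × ι => (p.1 : G) * f p.2) A := by
  refine ⟨fun p => mul_mem (h.1 p.1.2) (hHA (hf.1 _)), fun g hg => ?_⟩
  obtain ⟨c, ⟨hc, hcg⟩, huc⟩ := h.2 g hg
  obtain ⟨p, hp, hup⟩ := hf.2 _ hcg
  refine ⟨(⟨c, hc⟩, p), by simp [hp], ?_⟩
  rintro ⟨⟨d, hd⟩, q⟩ (rfl : d * f q = g)
  obtain rfl := huc d ⟨hd, by simpa using hf.1 q⟩
  rw [hup q (by simp)]

end Abstract

/-! ### Permutation matrices, diagonal matrices and block matrices -/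

section Embeddings

variable {n : Type} [Fintype n] [DecidableEq n]

/-- The unitary permuting the basis vectors: `permU σ` sends `|j⟩` to `|σ j⟩`. -/
def permU : Equiv.Perm n →* Matrix.unitaryGroup n ℂ where
  toFun σ := ⟨Matrix.of fun i j => if i = σ j then 1 else 0, by
    rw [Matrix.mem_unitaryGroup_iff']
    ext i j
    simp [Matrix.mul_apply, Matrix.star_apply, Matrix.one_apply, apply_ite, eq_comm]⟩
  map_one' := by
    ext i j
    simp only [Equiv.Perm.one_apply, Matrix.of_apply, Matrix.UnitaryGroup.one_apply,
      Matrix.one_apply]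
    rfl
  map_mul' σ τ := by
    ext i j
    simp only [Equiv.Perm.mul_apply, Matrix.UnitaryGroup.mul_val, Matrix.mul_apply,
      Matrix.of_apply, mul_ite, mul_one, mul_zero, Finset.sum_ite_eq', Finset.mem_univ, if_true]
    rfl

theorem permU_apply (σ : Equiv.Perm n) (i j : n) :
    (permU σ).1 i j = if i = σ j then 1 else 0 := rfl

theorem permU_injective : Function.Injective (permU (n := n)) := by
  intro σ τ h
  ext j
  have := congrArg (fun U : Matrix.unitaryGroup n ℂ => U.1 (σ j) j) h
  simp only [permU_apply, if_true] at this
  by_contra hne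
  rw [if_neg hne] at this
  exact one_ne_zero this

/-- The power `i ^ a`, for an exponent modulo `4`. -/
def iPow (a : ZMod 4) : ℂ := Complex.I ^ a.val

theorem orderOf_I : orderOf Complex.I = 4 := Complex.isPrimitiveRoot_I.eq_orderOf.symm

theorem iPow_zero : iPow 0 = 1 := by simp [iPow]

theorem iPow_one : iPow 1 = Complex.I := by
  rw [iPow, show (1 : ZMod 4).val = 1 from rfl, pow_one]

theorem iPow_add (a b : ZMod 4) : iPow (a + b) = iPow a * iPow b := by
  rw [iPow, iPow, iPow, ← pow_add, ZMod.val_add]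
  simpa [orderOf_I] using pow_mod_orderOf Complex.I (a.val + b.val)

theorem iPow_injective : Function.Injective iPow := by
  intro a b h
  refine ZMod.val_injective 4 (pow_injOn_Iio_orderOf (x := Complex.I) ?_ ?_ h) <;>
    simpa [orderOf_I] using ZMod.val_lt _

/-- The diagonal unitary with the powers `i ^ d j` on the diagonal. -/
def phaseU : Multiplicative (n → ZMod 4) →* Matrix.unitaryGroup n ℂ where
  toFun d := diagU (fun j => iPow (d.toAdd j)) (fun j => by
    rw [iPow, star_pow, ← mul_pow]
    simp)
  map_one' := by
    ext i j
    simp [diagU, iPow_zero]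
  map_mul' d e := by
    ext i j
    simp [diagU, iPow_add]

theorem phaseU_apply (d : n → ZMod 4) (i j : n) :
    (phaseU (.ofAdd d)).1 i j = if i = j then iPow (d i) else 0 := rfl

theorem phaseU_injective : Function.Injective (phaseU (n := n)) := by
  intro d e h
  funext j
  have := congrArg (fun U : Matrix.unitaryGroup n ℂ => U.1 j j) h
  have h' : iPow (d.toAdd j) = iPow (e.toAdd j) := by simpa [phaseU, diagU] using this
  exact iPow_injective h'

theorem permU_mul_phaseU (σ : Equiv.Perm n) (d : n → ZMod 4) :
    permU σ * phaseU (.ofAdd d) = phaseU (.ofAdd fun j => d (σ⁻¹ j)) * permU σ := by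
  ext i j
  simp only [Matrix.UnitaryGroup.mul_val, Matrix.mul_apply, permU_apply, phaseU_apply]
  simp only [ite_mul, one_mul, zero_mul, mul_ite, mul_one, mul_zero,
    Finset.mem_univ, if_true, Finset.sum_ite_eq']
  by_cases h : i = σ j
  · simp [h]
  · simp [h]

theorem permU_conj_phaseU (σ : Equiv.Perm n) (d : n → ZMod 4) :
    permU σ * phaseU (.ofAdd d) * (permU σ)⁻¹ = phaseU (.ofAdd fun j => d (σ⁻¹ j)) := by
  rw [permU_mul_phaseU, mul_inv_cancel_right]

/-- A permutation matrix that is diagonal is trivial. -/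
theorem eq_one_of_permU_eq_phaseU {σ : Equiv.Perm n} {d : Multiplicative (n → ZMod 4)}
    (h : permU σ = phaseU d) : σ = 1 := by
  ext j
  have := congrArg (fun U : Matrix.unitaryGroup n ℂ => U.1 (σ j) j) h
  by_contra hne
  simp only [permU_apply, if_true] at this
  rw [show d = .ofAdd d.toAdd from rfl, phaseU_apply, if_neg (by simpa using hne)] at this
  exact one_ne_zero this

/-- Block diagonal unitaries: a family of single-qubit unitaries, indexed by the values of two
control qubits. The bijection `e` says which of the three qubits is the target: `e (a, c)` is the
basis label with target value `a` and control values `c`. -/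
def blockU (e : Fin 2 × (Fin 2 × Fin 2) ≃ Basis3) :
    (Fin 2 × Fin 2 → Matrix.unitaryGroup (Fin 2) ℂ) →* U8 where
  toFun f := relabel e ⟨Matrix.blockDiagonal fun c => (f c).1, by
    rw [Matrix.mem_unitaryGroup_iff, Matrix.star_eq_conjTranspose,
      Matrix.blockDiagonal_conjTranspose, ← Matrix.blockDiagonal_mul, ← Matrix.blockDiagonal_one]
    congr 1
    funext c
    exact Matrix.mem_unitaryGroup_iff.1 (f c).2⟩
  map_one' := by
    apply Subtype.ext
    simp only [relabel, Pi.one_apply, Matrix.UnitaryGroup.one_val]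
    rw [show (fun _ : Fin 2 × Fin 2 => (1 : Matrix (Fin 2) (Fin 2) ℂ)) = 1 from rfl,
      Matrix.blockDiagonal_one]
    simp
  map_mul' f g := by
    apply Subtype.ext
    simp only [relabel, Pi.mul_apply, Matrix.UnitaryGroup.mul_val, Matrix.blockDiagonal_mul]
    simp [Matrix.submatrix_mul_equiv]

theorem blockU_apply (e : Fin 2 × (Fin 2 × Fin 2) ≃ Basis3)
    (f : Fin 2 × Fin 2 → Matrix.unitaryGroup (Fin 2) ℂ) (x y : Fin 2 × (Fin 2 × Fin 2)) :
    (blockU e f).1 (e x) (e y) = if x.2 = y.2 then (f x.2).1 x.1 y.1 else 0 := by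
  simp [blockU, relabel, Matrix.blockDiagonal_apply]

theorem eq_of_apply_equiv {m : Type} (e : m ≃ n) {U V : Matrix.unitaryGroup n ℂ}
    (h : ∀ x y, U.1 (e x) (e y) = V.1 (e x) (e y)) : U = V := by
  ext i j
  simpa using h (e.symm i) (e.symm j)

theorem blockU_injective (e : Fin 2 × (Fin 2 × Fin 2) ≃ Basis3) :
    Function.Injective (blockU e) := by
  intro f g h
  funext c
  ext a b
  have := congrArg (fun U : U8 => U.1 (e (a, c)) (e (b, c))) h
  simpa [blockU_apply] using this

theorem phaseU_eq_blockU (e : Fin 2 × (Fin 2 × Fin 2) ≃ Basis3) (d : Basis3 → ZMod 4) :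
    phaseU (.ofAdd d) = blockU e fun c => phaseU (.ofAdd fun a => d (e (a, c))) := by
  refine eq_of_apply_equiv e ?_
  rintro ⟨a, c⟩ ⟨a', c'⟩
  rw [blockU_apply, phaseU_apply, phaseU_apply]
  simp only [EmbeddingLike.apply_eq_iff_eq, Prod.mk.injEq]
  split_ifs <;> simp_all

/-- A permutation that moves only the target qubit, by `τ c` at control values `c`, has the blocks
`permU (τ c)`. -/
theorem permU_eq_blockU (e : Fin 2 × (Fin 2 × Fin 2) ≃ Basis3) {σ : Equiv.Perm Basis3}
    {τ : Fin 2 × Fin 2 → Equiv.Perm (Fin 2)} (h : ∀ a c, σ (e (a, c)) = e (τ c a, c)) :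
    permU σ = blockU e fun c => permU (τ c) := by
  refine eq_of_apply_equiv e ?_
  rintro ⟨a, c⟩ ⟨a', c'⟩
  rw [blockU_apply, permU_apply, permU_apply, h]
  simp only [EmbeddingLike.apply_eq_iff_eq, Prod.mk.injEq]
  split_ifs <;> simp_all

end Embeddings

/-! ### Exact computation with single-qubit gates -/

/-- `IsScaled k A U` says that `(1 + i) ^ k U` is the matrix `A` of Gaussian integers. Every
single-qubit identity between products of `K`, `S`, `X` and `i` becomes a decidable identity
between such matrices. -/
def IsScaled (k : ℕ) (A : Matrix (Fin 2) (Fin 2) GaussianInt)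
    (U : Matrix.unitaryGroup (Fin 2) ℂ) : Prop :=
  (1 + Complex.I) ^ k • U.1 = A.map GaussianInt.toComplex

theorem one_add_I_ne_zero : (1 + Complex.I) ≠ 0 := by
  intro h
  simpa using congrArg Complex.re h

theorem IsScaled.mul {k l : ℕ} {A B : Matrix (Fin 2) (Fin 2) GaussianInt}
    {U V : Matrix.unitaryGroup (Fin 2) ℂ} (hU : IsScaled k A U) (hV : IsScaled l B V) :
    IsScaled (k + l) (A * B) (U * V) := by
  unfold IsScaled at *
  rw [Matrix.map_mul, ← hU, ← hV, Matrix.UnitaryGroup.mul_val, Matrix.smul_mul, Matrix.mul_smul,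
    smul_smul, pow_add]

theorem IsScaled.pow {k : ℕ} {A : Matrix (Fin 2) (Fin 2) GaussianInt}
    {U : Matrix.unitaryGroup (Fin 2) ℂ} (hU : IsScaled k A U) (r : ℕ) :
    IsScaled (r * k) (A ^ r) (U ^ r) := by
  induction r with
  | zero => simp [IsScaled, Matrix.map_one]
  | succ r ih =>
    rw [pow_succ, pow_succ, Nat.succ_mul]
    exact ih.mul hU

/-- Two gates agree if their Gaussian integer matrices agree after clearing denominators. -/
theorem IsScaled.eq {k l : ℕ} {A B : Matrix (Fin 2) (Fin 2) GaussianInt}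
    {U V : Matrix.unitaryGroup (Fin 2) ℂ} (hU : IsScaled k A U) (hV : IsScaled l B V)
    (h : ∀ i j, (⟨1, 1⟩ : GaussianInt) ^ l * A i j = (⟨1, 1⟩ : GaussianInt) ^ k * B i j) :
    U = V := by
  ext i j
  have hU' := congrFun (congrFun hU i) j
  have hV' := congrFun (congrFun hV i) j
  have h' := congrArg GaussianInt.toComplex (h i j)
  simp only [Matrix.smul_apply, Matrix.map_apply, smul_eq_mul] at hU' hV'
  rw [map_mul, map_mul, map_pow, map_pow, ← hU', ← hV',
    show GaussianInt.toComplex ⟨1, 1⟩ = 1 + Complex.I by simp [GaussianInt.toComplex_def]] at h'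
  have h2 := pow_ne_zero (l + k) one_add_I_ne_zero
  rw [← mul_assoc, ← mul_assoc, ← pow_add, ← pow_add, add_comm k l] at h'
  exact mul_left_cancel₀ h2 h'

theorem isScaled_one : IsScaled 0 1 1 := by
  simp [IsScaled, Matrix.map_one]

theorem isScaled_K : IsScaled 1 !![1, 1; 1, -1] K := by
  have := mul_inv_cancel₀ one_add_I_ne_zero
  ext i j
  fin_cases i <;> fin_cases j <;> simp [K, this]

theorem isScaled_phaseU (d : Fin 2 → ZMod 4) :
    IsScaled 0 !![⟨0, 1⟩ ^ (d 0).val, 0; 0, ⟨0, 1⟩ ^ (d 1).val] (phaseU (.ofAdd d)) := by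
  have h : GaussianInt.toComplex ⟨0, 1⟩ = Complex.I := by simp [GaussianInt.toComplex_def]
  ext i j
  fin_cases i <;> fin_cases j <;> simp [phaseU_apply, h, iPow]

theorem isScaled_permU (σ : Equiv.Perm (Fin 2)) :
    IsScaled 0 (Matrix.of fun i j => if i = σ j then 1 else 0) (permU σ) := by
  ext i j
  simp [permU_apply, apply_ite]

/-! ### The gates as permutation, diagonal and block matrices -/

/-- Target qubit `0`; the controls are qubits `1` and `2`. -/
def target0 : Fin 2 × (Fin 2 × Fin 2) ≃ Basis3 := Equiv.refl _

/-- Target qubit `1`; the controls are qubits `0` and `2`. -/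
def target1 : Fin 2 × (Fin 2 × Fin 2) ≃ Basis3 where
  toFun x := (x.2.1, x.1, x.2.2)
  invFun x := (x.2.1, x.1, x.2.2)
  left_inv _ := rfl
  right_inv _ := rfl

/-- Target qubit `2`; the controls are qubits `0` and `1`. -/
def target2 : Fin 2 × (Fin 2 × Fin 2) ≃ Basis3 where
  toFun x := (x.2.1, x.2.2, x.1)
  invFun x := (x.2.2, x.1, x.2.1)
  left_inv _ := rfl
  right_inv _ := rfl

theorem K0_eq : K0 = blockU target0 fun _ => K := by
  refine eq_of_apply_equiv target0 ?_
  rintro ⟨a, b, c⟩ ⟨a', b', c'⟩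
  rw [blockU_apply]
  simp [K0, tensor, target0, Matrix.one_apply, Prod.ext_iff]

theorem K1_eq : K1 = blockU target1 fun _ => K := by
  refine eq_of_apply_equiv target1 ?_
  rintro ⟨a, b, c⟩ ⟨a', b', c'⟩
  rw [blockU_apply]
  simp [K1, tensor, target1, Matrix.one_apply, Prod.ext_iff]
  split_ifs <;> simp_all

theorem K2_eq : K2 = blockU target2 fun _ => K := by
  refine eq_of_apply_equiv target2 ?_
  rintro ⟨a, b, c⟩ ⟨a', b', c'⟩
  rw [blockU_apply]
  simp [K2, tensor, target2, Matrix.one_apply, Prod.ext_iff]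
  split_ifs <;> simp_all

theorem iG_eq : iG = phaseU (.ofAdd fun _ => 1) := by
  ext i j
  simp [iG, diagU, phaseU_apply, Matrix.diagonal_apply, iPow_one]

theorem S0_eq : S0 = phaseU (.ofAdd fun x => if x.1 = 1 then 1 else 0) := by
  ext ⟨a, b, c⟩ ⟨a', b', c'⟩
  simp [S0, S, tensor, diagU, phaseU_apply, Matrix.diagonal_apply, Matrix.one_apply,
    apply_ite iPow, iPow_one, iPow_zero]
  split_ifs <;> simp_all

theorem S1_eq : S1 = phaseU (.ofAdd fun x => if x.2.1 = 1 then 1 else 0) := by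
  ext ⟨a, b, c⟩ ⟨a', b', c'⟩
  simp [S1, S, tensor, diagU, phaseU_apply, Matrix.diagonal_apply, Matrix.one_apply,
    apply_ite iPow, iPow_one, iPow_zero]
  split_ifs <;> simp_all

theorem S2_eq : S2 = phaseU (.ofAdd fun x => if x.2.2 = 1 then 1 else 0) := by
  ext ⟨a, b, c⟩ ⟨a', b', c'⟩
  simp [S2, S, tensor, diagU, phaseU_apply, Matrix.diagonal_apply, Matrix.one_apply,
    apply_ite iPow, iPow_one, iPow_zero]
  split_ifs <;> simp_all

theorem CS01_eq : CS01 = phaseU (.ofAdd fun x => if x.1 = 1 ∧ x.2.1 = 1 then 1 else 0) := by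
  ext ⟨a, b, c⟩ ⟨a', b', c'⟩
  simp [CS01, CS, tensor, relabel, diagU, phaseU_apply, Matrix.diagonal_apply, Matrix.one_apply,
    apply_ite iPow, iPow_one, iPow_zero]
  split_ifs <;> grind

theorem CS12_eq : CS12 = phaseU (.ofAdd fun x => if x.2.1 = 1 ∧ x.2.2 = 1 then 1 else 0) := by
  ext ⟨a, b, c⟩ ⟨a', b', c'⟩
  simp [CS12, CS, tensor, diagU, phaseU_apply, Matrix.diagonal_apply, Matrix.one_apply,
    apply_ite iPow, iPow_one, iPow_zero]
  split_ifs <;> grind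

/-- `K diag(1, (-1)^p) K i` is `X` if `p` holds and the identity otherwise. -/
theorem K_mul_phaseU_mul_K (p : Prop) [Decidable p] {d : Fin 2 → ZMod 4}
    (hd : ∀ a, d a = if a = 1 ∧ p then 2 else 0) :
    K * phaseU (.ofAdd d) * K * phaseU (.ofAdd fun _ => 1) =
      permU (if p then Equiv.swap 0 1 else 1) := by
  have hscaled := fun d σ (h : _) => (((isScaled_K.mul (isScaled_phaseU d)).mul isScaled_K).mul
    (isScaled_phaseU fun _ => 1)).eq (isScaled_permU σ) h
  by_cases hp : p
  · obtain rfl : d = ![0, 2] := by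
      ext a
      fin_cases a <;> simp [hd, hp]
    rw [if_pos hp]
    exact hscaled _ _ (by decide)
  · obtain rfl : d = ![0, 0] := by
      ext a
      fin_cases a <;> simp [hd, hp]
    rw [if_neg hp]
    exact hscaled _ _ (by decide)

/-- Conjugating a controlled `Z` gate by `K` on the target (and correcting the phase) gives the
corresponding controlled `X` gate. -/
theorem conj_K_phaseU (e : Fin 2 × (Fin 2 × Fin 2) ≃ Basis3) (p : Fin 2 × Fin 2 → Prop)
    [DecidablePred p] {d : Basis3 → ZMod 4} {σ : Equiv.Perm Basis3}
    (hd : ∀ a c, d (e (a, c)) = if a = 1 ∧ p c then 2 else 0)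
    (hσ : ∀ a c, σ (e (a, c)) = e ((if p c then Equiv.swap 0 1 else 1 : Equiv.Perm (Fin 2)) a, c)) :
    (blockU e fun _ => K) * phaseU (.ofAdd d) * (blockU e fun _ => K) * iG = permU σ := by
  rw [iG_eq, phaseU_eq_blockU e, phaseU_eq_blockU e, permU_eq_blockU e hσ, ← map_mul, ← map_mul,
    ← map_mul]
  congr 1
  funext c
  exact K_mul_phaseU_mul_K (p c) fun a => hd a c

/-- The Pauli gate `X` on qubit `0`, as a permutation of the basis labels. -/
def permX0 : Equiv.Perm Basis3 :=
  Function.Involutive.toPerm (fun x => (x.1 + 1, x.2.1, x.2.2))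
    (by unfold Function.Involutive; decide)

/-- The Pauli gate `X` on qubit `1`, as a permutation of the basis labels. -/
def permX1 : Equiv.Perm Basis3 :=
  Function.Involutive.toPerm (fun x => (x.1, x.2.1 + 1, x.2.2))
    (by unfold Function.Involutive; decide)

/-- The Pauli gate `X` on qubit `2`, as a permutation of the basis labels. -/
def permX2 : Equiv.Perm Basis3 :=
  Function.Involutive.toPerm (fun x => (x.1, x.2.1, x.2.2 + 1))
    (by unfold Function.Involutive; decide)

/-- Controlled `X`, control qubit `0`, target qubit `1`, as a permutation of the basis labels. -/
def permCX01 : Equiv.Perm Basis3 :=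
  Function.Involutive.toPerm (fun x => (x.1, x.2.1 + x.1, x.2.2))
    (by unfold Function.Involutive; decide)

/-- Controlled `X`, control qubit `1`, target qubit `0`. -/
def permCX10 : Equiv.Perm Basis3 :=
  Function.Involutive.toPerm (fun x => (x.1 + x.2.1, x.2.1, x.2.2))
    (by unfold Function.Involutive; decide)

/-- Controlled `X`, control qubit `2`, target qubit `0`. -/
def permCX20 : Equiv.Perm Basis3 :=
  Function.Involutive.toPerm (fun x => (x.1 + x.2.2, x.2.1, x.2.2))
    (by unfold Function.Involutive; decide)

/-- Controlled `X`, control qubit `1`, target qubit `2`. -/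
def permCX12 : Equiv.Perm Basis3 :=
  Function.Involutive.toPerm (fun x => (x.1, x.2.1, x.2.2 + x.2.1))
    (by unfold Function.Involutive; decide)

/-- Controlled `X`, control qubit `2`, target qubit `1`. -/
def permCX21 : Equiv.Perm Basis3 :=
  Function.Involutive.toPerm (fun x => (x.1, x.2.1 + x.2.2, x.2.2))
    (by unfold Function.Involutive; decide)

/-- The Toffoli gate with target qubit `0`, as a permutation of the basis labels. -/
def permCCX0 : Equiv.Perm Basis3 :=
  Function.Involutive.toPerm (fun x => (x.1 + x.2.1 * x.2.2, x.2.1, x.2.2))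
    (by unfold Function.Involutive; decide)

/-- The exchange of qubits `1` and `2`, as a permutation of the basis labels. -/
def permSwap12 : Equiv.Perm Basis3 :=
  Function.Involutive.toPerm (fun x => (x.1, x.2.2, x.2.1))
    (by unfold Function.Involutive; decide)

theorem X0_eq : X0 = permU permX0 := by
  rw [X0, K0_eq, S0_eq, mul_assoc (blockU _ _) (phaseU _), ← map_mul, ← ofAdd_add]
  exact conj_K_phaseU target0 (fun _ => True) (by decide) (by decide)

theorem X1_eq : X1 = permU permX1 := by
  rw [X1, K1_eq, S1_eq, mul_assoc (blockU _ _) (phaseU _), ← map_mul, ← ofAdd_add]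
  exact conj_K_phaseU target1 (fun _ => True) (by decide) (by decide)

theorem X2_eq : X2 = permU permX2 := by
  rw [X2, K2_eq, S2_eq, mul_assoc (blockU _ _) (phaseU _), ← map_mul, ← ofAdd_add]
  exact conj_K_phaseU target2 (fun _ => True) (by decide) (by decide)

theorem CX01_eq : CX01 = permU permCX01 := by
  rw [CX01, K1_eq, CS01_eq, mul_assoc (blockU _ _) (phaseU _), ← map_mul, ← ofAdd_add]
  exact conj_K_phaseU target1 (fun c => c.1 = 1) (by decide) (by decide)

theorem CX10_eq : CX10 = permU permCX10 := by
  rw [CX10, K0_eq, CS01_eq, mul_assoc (blockU _ _) (phaseU _), ← map_mul, ← ofAdd_add]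
  exact conj_K_phaseU target0 (fun c => c.1 = 1) (by decide) (by decide)

theorem CX12_eq : CX12 = permU permCX12 := by
  rw [CX12, K2_eq, CS12_eq, mul_assoc (blockU _ _) (phaseU _), ← map_mul, ← ofAdd_add]
  exact conj_K_phaseU target2 (fun c => c.2 = 1) (by decide) (by decide)

theorem CX21_eq : CX21 = permU permCX21 := by
  rw [CX21, K1_eq, CS12_eq, mul_assoc (blockU _ _) (phaseU _), ← map_mul, ← ofAdd_add]
  exact conj_K_phaseU target1 (fun c => c.2 = 1) (by decide) (by decide)

theorem Swap12_eq : Swap12 = permU permSwap12 := by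
  rw [Swap12, CX12_eq, CX21_eq, ← map_mul, ← map_mul]
  exact congrArg permU (by decide)

theorem CS02_eq : CS02 = phaseU (.ofAdd fun x => if x.1 = 1 ∧ x.2.2 = 1 then 1 else 0) := by
  rw [CS02, Swap12_eq, CS01_eq, permU_mul_phaseU, mul_assoc, ← map_mul,
    show permSwap12 * permSwap12 = 1 by decide, map_one, mul_one]
  congr 2

theorem CX20_eq : CX20 = permU permCX20 := by
  rw [CX20, K0_eq, CS02_eq, mul_assoc (blockU _ _) (phaseU _), ← map_mul, ← ofAdd_add]
  exact conj_K_phaseU target0 (fun c => c.2 = 1) (by decide) (by decide)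

theorem CCZ_eq :
    CCZ = phaseU (.ofAdd fun x => if x.1 = 1 ∧ x.2.1 = 1 ∧ x.2.2 = 1 then 2 else 0) := by
  have h : CCZ = CS01 * (CX21 * (CS01 * CS01 * CS01)) * CX21 * CS02 := by
    simp only [CCZ, mul_assoc]
  rw [h, CX21_eq, CS01_eq, CS02_eq, ← map_mul, ← map_mul, ← ofAdd_add, ← ofAdd_add,
    permU_mul_phaseU, ← mul_assoc, mul_assoc (_ * _) (permU _) (permU _), ← map_mul permU,
    show permCX21 * permCX21 = 1 by decide, map_one, mul_one, ← map_mul, ← map_mul, ← ofAdd_add,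
    ← ofAdd_add]
  congr 2
  decide

theorem CCX0_eq : CCX0 = permU permCCX0 := by
  rw [CCX0, K0_eq, CCZ_eq]
  exact conj_K_phaseU target0 (fun c => c.1 = 1 ∧ c.2 = 1) (by decide) (by decide)

/-! ### The permutation groups -/

/-- The generators of `Q` as permutations of the basis labels. -/
def permGenQ : Set (Equiv.Perm Basis3) := {permX0, permCX10, permCX20, permCCX0}
/-- The generators of `C` as permutations of the basis labels. -/
def permGenC : Set (Equiv.Perm Basis3) := {permX1, permCX12, permCX21}
/-- The generators of `P` as permutations of the basis labels. -/
def permGenP : Set (Equiv.Perm Basis3) :=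
  {permCX01, permCX10, permCX12, permCX21, permCCX0, permX0}

theorem image_permGenQ : permU '' permGenQ = genQ := by
  simp [permGenQ, genQ, Set.image_insert_eq, X0_eq, CX10_eq, CX20_eq, CCX0_eq]

theorem image_permGenC : permU '' permGenC = genC := by
  simp [permGenC, genC, Set.image_insert_eq, X1_eq, CX12_eq, CX21_eq]

theorem image_permGenP : permU '' permGenP = genP := by
  simp [permGenP, genP, Set.image_insert_eq, X0_eq, CX10_eq, CX01_eq, CX12_eq, CX21_eq, CCX0_eq]

theorem Q_eq_map : Q = (Subgroup.closure permGenQ).map permU := by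
  rw [Q, MonoidHom.map_closure, image_permGenQ]

theorem C_eq_map : C = (Subgroup.closure permGenC).map permU := by
  rw [C, MonoidHom.map_closure, image_permGenC]

theorem P_eq_map : P = (Subgroup.closure permGenP).map permU := by
  rw [P, MonoidHom.map_closure, image_permGenP]

/-- The permutation of the basis labels given by `nfQ p`. -/
def permNfQ : IdxQ → Equiv.Perm Basis3
  | (a, b, c, d) =>
    permX0 ^ (a : ℕ) * permCX10 ^ (b : ℕ) * permCX20 ^ (c : ℕ) * permCCX0 ^ (d : ℕ)

/-- The permutation of the basis labels given by `nfC p`. -/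
def permNfC : IdxC → Equiv.Perm Basis3
  | ((a, b), s, t) =>
    (permX1 ^ (a : ℕ) * permX2 ^ (b : ℕ)) *
      (![1, permCX21, permCX12 * permCX21] : Fin 3 → Equiv.Perm Basis3) s *
      (![1, permCX12] : Fin 2 → Equiv.Perm Basis3) t

theorem nfQ_eq (p : IdxQ) : nfQ p = permU (permNfQ p) := by
  simp [nfQ, permNfQ, X0_eq, CX10_eq, CX20_eq, CCX0_eq]

theorem nfC_eq (p : IdxC) : nfC p = permU (permNfC p) := by
  obtain ⟨⟨a, b⟩, s, t⟩ := p
  fin_cases s <;> fin_cases t <;> simp [nfC, permNfC, X1_eq, X2_eq, CX12_eq, CX21_eq]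

theorem permNfQ_injective : Function.Injective permNfQ := by
  have : ∀ p q, permNfQ p = permNfQ q → p = q := by decide +kernel
  exact this

theorem permNfC_injective : Function.Injective permNfC := by
  have : ∀ p q, permNfC p = permNfC q → p = q := by decide +kernel
  exact this

theorem isNormalForm_permNfQ : IsNormalForm permNfQ (Subgroup.closure permGenQ) := by
  refine isNormalForm_closure permNfQ_injective ?_ ⟨(0, 0, 0, 0), by decide⟩ ?_
  · rintro ⟨a, b, c, d⟩
    refine mul_mem (mul_mem (mul_mem ?_ ?_) ?_) ?_ <;>
      exact pow_mem (Subgroup.subset_closure (by simp [permGenQ])) _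
  · have h0 : ∀ p, ∃ q, permNfQ q = permX0 * permNfQ p := by decide +kernel
    have h1 : ∀ p, ∃ q, permNfQ q = permCX10 * permNfQ p := by decide +kernel
    have h2 : ∀ p, ∃ q, permNfQ q = permCX20 * permNfQ p := by decide +kernel
    have h3 : ∀ p, ∃ q, permNfQ q = permCCX0 * permNfQ p := by decide +kernel
    rintro g (rfl | rfl | rfl | rfl) <;> assumption

theorem isNormalForm_permNfC : IsNormalForm permNfC (Subgroup.closure permGenC) := by
  have hX1 : permX1 ∈ Subgroup.closure permGenC :=
    Subgroup.subset_closure (by simp [permGenC])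
  have hCX12 : permCX12 ∈ Subgroup.closure permGenC :=
    Subgroup.subset_closure (by simp [permGenC])
  have hCX21 : permCX21 ∈ Subgroup.closure permGenC :=
    Subgroup.subset_closure (by simp [permGenC])
  have hX2 : permX2 ∈ Subgroup.closure permGenC := by
    rw [show permX2 = permX1 * permCX12 * permX1 * permCX12 by decide]
    exact mul_mem (mul_mem (mul_mem hX1 hCX12) hX1) hCX12
  refine isNormalForm_closure permNfC_injective ?_ ⟨((0, 0), 0, 0), by decide⟩ ?_
  · rintro ⟨⟨a, b⟩, s, t⟩
    refine mul_mem (mul_mem (mul_mem (pow_mem hX1 _) (pow_mem hX2 _)) ?_) ?_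
    · fin_cases s
      exacts [one_mem _, hCX21, mul_mem hCX12 hCX21]
    · fin_cases t
      exacts [one_mem _, hCX12]
  · have h0 : ∀ p, ∃ q, permNfC q = permX1 * permNfC p := by decide +kernel
    have h1 : ∀ p, ∃ q, permNfC q = permCX12 * permNfC p := by decide +kernel
    have h2 : ∀ p, ∃ q, permNfC q = permCX21 * permNfC p := by decide +kernel
    rintro g (rfl | rfl | rfl) <;> assumption

theorem isNormalForm_nfQ : IsNormalForm nfQ Q := by
  rw [Q_eq_map, funext nfQ_eq]
  exact isNormalForm_permNfQ.map permU_injective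

theorem isNormalForm_nfC : IsNormalForm nfC C := by
  rw [C_eq_map, funext nfC_eq]
  exact isNormalForm_permNfC.map permU_injective

theorem permC_conj_permQ {σ τ : Equiv.Perm Basis3} (hσ : σ ∈ Subgroup.closure permGenC)
    (hτ : τ ∈ Subgroup.closure permGenQ) : σ * τ * σ⁻¹ ∈ Subgroup.closure permGenQ := by
  refine conj_mem_closure ?_ hσ hτ
  have h0 : ∀ p, ∃ q, permNfQ q = permNfC p * permX0 * (permNfC p)⁻¹ := by decide +kernel
  have h1 : ∀ p, ∃ q, permNfQ q = permNfC p * permCX10 * (permNfC p)⁻¹ := by decide +kernel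
  have h2 : ∀ p, ∃ q, permNfQ q = permNfC p * permCX20 * (permNfC p)⁻¹ := by decide +kernel
  have h3 : ∀ p, ∃ q, permNfQ q = permNfC p * permCCX0 * (permNfC p)⁻¹ := by decide +kernel
  intro a ha b hb
  obtain ⟨p, rfl⟩ := isNormalForm_permNfC.exists_eq ha
  have h : ∃ q, permNfQ q = permNfC p * b * (permNfC p)⁻¹ := by
    rcases hb with rfl | rfl | rfl | rfl
    exacts [h0 p, h1 p, h2 p, h3 p]
  obtain ⟨q, hq⟩ := h
  rw [← hq]
  exact isNormalForm_permNfQ.1 q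

theorem permC_inf_permQ : Subgroup.closure permGenC ⊓ Subgroup.closure permGenQ = ⊥ := by
  have h : ∀ p q, permNfC p = permNfQ q → permNfC p = 1 := by decide +kernel
  rw [eq_bot_iff]
  rintro σ ⟨hC, hQ⟩
  obtain ⟨p, rfl⟩ := isNormalForm_permNfC.exists_eq hC
  obtain ⟨q, hq⟩ := isNormalForm_permNfQ.exists_eq hQ
  exact h p q hq.symm

theorem CQ_eq_sup : CQ = C ⊔ Q := by
  rw [CQ, C, Q, Subgroup.closure_union]

theorem isSemidirect_CQ : IsSemidirect CQ C Q := by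
  rw [CQ_eq_sup]
  refine isSemidirect_sup ?_ ?_
  · rw [C_eq_map, Q_eq_map]
    rintro _ ⟨σ, hσ, rfl⟩ _ ⟨τ, hτ, rfl⟩
    exact ⟨_, permC_conj_permQ hσ hτ, by simp⟩
  · rw [C_eq_map, Q_eq_map, ← Subgroup.map_inf_eq _ _ _ permU_injective, permC_inf_permQ,
      Subgroup.map_bot]

theorem isNormalForm_nfCQ : IsNormalForm nfCQ CQ :=
  isSemidirect_CQ.isNormalForm_mul isNormalForm_nfC isNormalForm_nfQ

/-- The gates of `P` generate the full symmetric group on the basis labels: `CCX₀` is a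
transposition of two labels, and these labels are adjacent on an `8`-cycle in the group. -/
theorem closure_permGenP : Subgroup.closure permGenP = ⊤ := by
  have hmem : ∀ {τ}, τ ∈ permGenP → τ ∈ Subgroup.closure permGenP :=
    fun h => Subgroup.subset_closure h
  -- An `8`-cycle that maps `(1, 1, 1)` to `(0, 1, 1)`, the two labels exchanged by `CCX₀`.
  let σ : Equiv.Perm Basis3 := permX0 * permCX01 * permCX12 * permCCX0 * permCX01
  have hreach : ∀ y, ∃ n : Fin 8, (σ ^ (n : ℕ)) (0, 0, 0) = y := by decide +kernel
  have hmove : ∀ y, σ y ≠ y := by decide +kernel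
  have hcycle : σ.IsCycle := by
    refine ⟨(0, 0, 0), hmove _, fun y _ => ?_⟩
    obtain ⟨n, hn⟩ := hreach y
    exact ⟨(n : ℕ), by simpa using hn⟩
  have hsupp : σ.support = Finset.univ := by
    ext y
    simpa using hmove y
  have hswap : Equiv.swap (1, 1, 1) (σ (1, 1, 1)) = permCCX0 := by decide +kernel
  rw [eq_top_iff, ← Equiv.Perm.closure_cycle_adjacent_swap hcycle hsupp (1, 1, 1),
    Subgroup.closure_le, hswap]
  rintro τ (rfl | rfl)
  · exact mul_mem (mul_mem (mul_mem (mul_mem (hmem (by simp [permGenP]))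
      (hmem (by simp [permGenP]))) (hmem (by simp [permGenP]))) (hmem (by simp [permGenP])))
      (hmem (by simp [permGenP]))
  · exact hmem (by simp [permGenP])

theorem P_eq_range : P = permU.range := by
  rw [P_eq_map, closure_permGenP, MonoidHom.range_eq_map]

theorem finite_P : Finite P := by
  rw [P_eq_range]
  infer_instance

theorem C_le_P : C ≤ P := by
  rw [C_eq_map, P_eq_range]
  exact Subgroup.map_le_range _ _

theorem Q_le_P : Q ≤ P := by
  rw [Q_eq_map, P_eq_range]
  exact Subgroup.map_le_range _ _

theorem CQ_le_P : CQ ≤ P := by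
  rw [CQ_eq_sup]
  exact sup_le C_le_P Q_le_P

theorem natCard_P : Nat.card P = 40320 := by
  rw [P_eq_range, ← Nat.card_congr (MonoidHom.ofInjective permU_injective).toEquiv,
    Nat.card_eq_fintype_card, Fintype.card_perm]
  simp
  decide

theorem relIndex_CQ_P : CQ.relIndex P = 105 := by
  have h := Subgroup.card_mul_index (CQ.subgroupOf P)
  rw [Nat.card_congr (Subgroup.subgroupOfEquivOfLe CQ_le_P).toEquiv, isNormalForm_nfCQ.natCard,
    natCard_P] at h
  simp at h
  change (CQ.subgroupOf P).index = 105
  omega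

theorem isNormalForm_nfP {V : Set U8} (hV : IsLeftCosetReps V P CQ) : IsNormalForm (nfP V) P :=
  hV.isNormalForm_mul CQ_le_P isNormalForm_nfCQ

/-! ### The diagonal group -/

/-- Exponent vectors `d` for which `∑ j, d j` is even. -/
def evenPhase : Subgroup (Multiplicative (Basis3 → ZMod 4)) where
  carrier := {d | 2 * ∑ j, d.toAdd j = 0}
  one_mem' := by simp
  mul_mem' {d e} hd he := by
    simp only [Set.mem_ofPred_eq, toAdd_mul, Pi.add_apply, Finset.sum_add_distrib, mul_add] at *
    rw [hd, he, add_zero]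
  inv_mem' {d} hd := by
    simp only [Set.mem_ofPred_eq, toAdd_inv, Pi.neg_apply, Finset.sum_neg_distrib, mul_neg] at *
    rw [hd, neg_zero]

theorem ofAdd_mem_evenPhase {d : Basis3 → ZMod 4} :
    Multiplicative.ofAdd d ∈ evenPhase ↔ 2 * ∑ j, d j = 0 := Iff.rfl

/-- The exponent vector of `nfD n`, a polynomial in the bits of the basis label. -/
def expD : IdxD → Basis3 → ZMod 4
  | (n0, n1, n2, n3, n4, n5, n6, n7), x =>
    (n0 : ℕ) + (n1 : ℕ) * (if x.1 = 1 then 1 else 0) + (n2 : ℕ) * (if x.2.1 = 1 then 1 else 0) +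
      (n3 : ℕ) * (if x.2.2 = 1 then 1 else 0) + (n4 : ℕ) * (if x.1 = 1 ∧ x.2.1 = 1 then 1 else 0) +
      (n5 : ℕ) * (if x.2.1 = 1 ∧ x.2.2 = 1 then 1 else 0) +
      (n6 : ℕ) * (if x.1 = 1 ∧ x.2.2 = 1 then 1 else 0) +
      (n7 : ℕ) * (if x.1 = 1 ∧ x.2.1 = 1 ∧ x.2.2 = 1 then 2 else 0)

theorem nfD_eq (n : IdxD) : nfD n = phaseU (.ofAdd (expD n)) := by
  obtain ⟨n0, n1, n2, n3, n4, n5, n6, n7⟩ := n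
  simp only [nfD, iG_eq, S0_eq, S1_eq, S2_eq, CS01_eq, CS12_eq, CS02_eq, CCZ_eq, ← map_pow,
    ← map_mul, ← ofAdd_nsmul, ← ofAdd_add]
  congr 2
  funext x
  simp only [Pi.add_apply, Pi.mul_apply, Pi.natCast_apply, nsmul_eq_mul, expD, mul_one]

theorem expD_injective : Function.Injective expD := by
  have h4 : ∀ {a b : Fin 4}, ((a : ℕ) : ZMod 4) = (b : ℕ) → a = b := by decide
  have h2 : ∀ {a b : Fin 2}, ((a : ℕ) : ZMod 4) * 2 = (b : ℕ) * 2 → a = b := by decide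
  rintro ⟨n0, n1, n2, n3, n4, n5, n6, n7⟩ ⟨m0, m1, m2, m3, m4, m5, m6, m7⟩ h
  have e0 := congrFun h (0, 0, 0)
  have e1 := congrFun h (1, 0, 0)
  have e2 := congrFun h (0, 1, 0)
  have e3 := congrFun h (0, 0, 1)
  have e4 := congrFun h (1, 1, 0)
  have e5 := congrFun h (0, 1, 1)
  have e6 := congrFun h (1, 0, 1)
  have e7 := congrFun h (1, 1, 1)
  simp [expD] at e0 e1 e2 e3 e4 e5 e6 e7
  obtain rfl := h4 e0
  obtain rfl := h4 (add_left_cancel e1)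
  obtain rfl := h4 (add_left_cancel e2)
  obtain rfl := h4 (add_left_cancel e3)
  obtain rfl := h4 (add_left_cancel e4)
  obtain rfl := h4 (add_left_cancel e5)
  obtain rfl := h4 (add_left_cancel e6)
  obtain rfl := h2 (add_left_cancel e7)
  rfl

theorem sum_basis3 (d : Basis3 → ZMod 4) :
    ∑ j, d j = d (0, 0, 0) + d (0, 0, 1) + d (0, 1, 0) + d (0, 1, 1) + d (1, 0, 0) +
      d (1, 0, 1) + d (1, 1, 0) + d (1, 1, 1) := by
  simp only [Fintype.sum_prod_type, Fin.sum_univ_two]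
  ring

/-- Möbius inversion over the subsets of the three bits: the exponents of `i`, `S_j` and `CS_{jk}`
are found from the labels with at most two bits set, and the parity condition makes what remains at
`(1, 1, 1)` a multiple of `2`. -/
theorem exists_expD_eq {d : Basis3 → ZMod 4} (hd : 2 * ∑ j, d j = 0) : ∃ n, expD n = d := by
  have h4 : ∀ a : ZMod 4, ∃ n : Fin 4, ((n : ℕ) : ZMod 4) = a := by decide
  have h2 : ∀ a : ZMod 4, 2 * a = 0 → ∃ n : Fin 2, ((n : ℕ) : ZMod 4) * 2 = a := by decide
  obtain ⟨n0, h0⟩ := h4 (d (0, 0, 0))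
  obtain ⟨n1, h1⟩ := h4 (d (1, 0, 0) - d (0, 0, 0))
  obtain ⟨n2, h2'⟩ := h4 (d (0, 1, 0) - d (0, 0, 0))
  obtain ⟨n3, h3⟩ := h4 (d (0, 0, 1) - d (0, 0, 0))
  obtain ⟨n4, h4'⟩ := h4 (d (1, 1, 0) - d (1, 0, 0) - d (0, 1, 0) + d (0, 0, 0))
  obtain ⟨n5, h5⟩ := h4 (d (0, 1, 1) - d (0, 1, 0) - d (0, 0, 1) + d (0, 0, 0))
  obtain ⟨n6, h6⟩ := h4 (d (1, 0, 1) - d (1, 0, 0) - d (0, 0, 1) + d (0, 0, 0))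
  obtain ⟨n7, h7⟩ := h2 (d (1, 1, 1) - d (1, 1, 0) - d (1, 0, 1) - d (0, 1, 1) + d (1, 0, 0) +
      d (0, 1, 0) + d (0, 0, 1) - d (0, 0, 0)) (by
    rw [sum_basis3] at hd
    have hfour : (4 : ZMod 4) = 0 := rfl
    linear_combination hd -
      (d (1, 1, 0) + d (1, 0, 1) + d (0, 1, 1) + d (0, 0, 0)) * hfour)
  refine ⟨(n0, n1, n2, n3, n4, n5, n6, n7), ?_⟩
  funext x
  obtain ⟨a, b, c⟩ := x
  fin_cases a <;> fin_cases b <;> fin_cases c <;> simp [expD, h7] <;>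
    simp only [h0, h1, h2', h3, h4', h5, h6] <;> ring

theorem D_le_map_evenPhase : D ≤ evenPhase.map phaseU := by
  rw [D, Subgroup.closure_le]
  rintro g (rfl | rfl | rfl | rfl | rfl | rfl | rfl | rfl)
  · exact ⟨_, ofAdd_mem_evenPhase.2 (by decide), iG_eq.symm⟩
  · exact ⟨_, ofAdd_mem_evenPhase.2 (by decide), S0_eq.symm⟩
  · exact ⟨_, ofAdd_mem_evenPhase.2 (by decide), S1_eq.symm⟩
  · exact ⟨_, ofAdd_mem_evenPhase.2 (by decide), S2_eq.symm⟩
  · exact ⟨_, ofAdd_mem_evenPhase.2 (by decide), CS01_eq.symm⟩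
  · exact ⟨_, ofAdd_mem_evenPhase.2 (by decide), CS12_eq.symm⟩
  · exact ⟨_, ofAdd_mem_evenPhase.2 (by decide), CS02_eq.symm⟩
  · exact ⟨_, ofAdd_mem_evenPhase.2 (by decide), CCZ_eq.symm⟩

theorem nfD_mem (n : IdxD) : nfD n ∈ D := by
  obtain ⟨n0, n1, n2, n3, n4, n5, n6, n7⟩ := n
  refine mul_mem (mul_mem (mul_mem (mul_mem (mul_mem (mul_mem (mul_mem ?_ ?_) ?_) ?_) ?_) ?_) ?_) ?_
    <;> exact pow_mem (Subgroup.subset_closure (by simp [genD])) _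

theorem isNormalForm_nfD : IsNormalForm nfD D := by
  rw [isNormalForm_iff]
  constructor
  · intro m n h
    rw [nfD_eq, nfD_eq] at h
    exact expD_injective (Multiplicative.ofAdd.injective (phaseU_injective h))
  · refine Set.Subset.antisymm ?_ fun g hg => ?_
    · rintro _ ⟨n, rfl⟩
      exact nfD_mem n
    · obtain ⟨d, hd, rfl⟩ := D_le_map_evenPhase hg
      obtain ⟨n, hn⟩ := exists_expD_eq hd
      exact ⟨n, by rw [nfD_eq, hn]; rfl⟩

theorem D_eq_map : D = evenPhase.map phaseU := by
  refine le_antisymm D_le_map_evenPhase ?_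
  rintro _ ⟨d, hd, rfl⟩
  obtain ⟨n, hn⟩ := exists_expD_eq hd
  have := nfD_mem n
  rwa [nfD_eq, hn] at this

theorem P_conj_D {a g : U8} (ha : a ∈ P) (hg : g ∈ D) : a * g * a⁻¹ ∈ D := by
  rw [P_eq_range] at ha
  rw [D_eq_map] at hg ⊢
  obtain ⟨σ, rfl⟩ := ha
  obtain ⟨d, hd, rfl⟩ := hg
  refine ⟨_, ?_, (permU_conj_phaseU σ d.toAdd).symm⟩
  rw [SetLike.mem_coe, ofAdd_mem_evenPhase, Equiv.sum_comp σ⁻¹ d.toAdd]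
  exact hd

theorem P_inf_D : P ⊓ D = ⊥ := by
  rw [eq_bot_iff, P_eq_range, D_eq_map]
  rintro _ ⟨⟨σ, rfl⟩, ⟨d, -, hd⟩⟩
  rw [eq_one_of_permU_eq_phaseU hd.symm, map_one]
  exact one_mem _

theorem isSemidirect_PD : IsSemidirect PD P D := by
  have : PD = P ⊔ D := by rw [PD, P, D, Subgroup.closure_union]
  rw [this]
  exact isSemidirect_sup (fun a ha g hg => P_conj_D ha hg) P_inf_D

theorem QD_eq_sup : QD = Q ⊔ D := by
  rw [QD, Q, D, Subgroup.closure_union]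

theorem isSemidirect_QD : IsSemidirect QD Q D := by
  rw [QD_eq_sup]
  refine isSemidirect_sup (fun a ha g hg => P_conj_D (Q_le_P ha) hg) ?_
  rw [eq_bot_iff, ← P_inf_D]
  exact inf_le_inf_right _ Q_le_P

theorem isNormalForm_nfQD : IsNormalForm nfQD QD :=
  isSemidirect_QD.isNormalForm_mul isNormalForm_nfQ isNormalForm_nfD

theorem isNormalForm_nfPD {V : Set U8} (hV : IsLeftCosetReps V P CQ) :
    IsNormalForm (nfPD V) PD :=
  isSemidirect_PD.isNormalForm_mul (isNormalForm_nfP hV) isNormalForm_nfD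

/-! ### The single-qubit Clifford group -/

/-- Monomial unitaries: products of a diagonal matrix of powers of `i` and a permutation matrix. -/
def monomialGroup (n : Type) [Fintype n] [DecidableEq n] :
    Subgroup (Matrix.unitaryGroup n ℂ) where
  carrier := {U | ∃ d σ, phaseU (.ofAdd d) * permU σ = U}
  one_mem' := ⟨0, 1, by simp⟩
  mul_mem' := by
    rintro _ _ ⟨d, σ, rfl⟩ ⟨e, τ, rfl⟩
    refine ⟨d + fun j => e (σ⁻¹ j), σ * τ, ?_⟩
    rw [ofAdd_add, map_mul, map_mul, mul_assoc, mul_assoc, ← mul_assoc (permU σ),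
      permU_mul_phaseU, mul_assoc]
  inv_mem' := by
    rintro _ ⟨d, σ, rfl⟩
    refine ⟨fun j => (-d) (σ j), σ⁻¹, ?_⟩
    have := permU_mul_phaseU σ⁻¹ (-d)
    rw [inv_inv] at this
    rw [← this, mul_inv_rev, ofAdd_neg, map_inv, map_inv]

theorem phaseU_mem_monomialGroup {n : Type} [Fintype n] [DecidableEq n] (d : n → ZMod 4) :
    phaseU (.ofAdd d) ∈ monomialGroup n := ⟨d, 1, by simp⟩

theorem permU_mem_monomialGroup {n : Type} [Fintype n] [DecidableEq n] (σ : Equiv.Perm n) :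
    permU σ ∈ monomialGroup n := ⟨0, σ, by simp⟩

instance finite_monomialGroup (n : Type) [Fintype n] [DecidableEq n] :
    Finite (monomialGroup n) := by
  have : (monomialGroup n : Set (Matrix.unitaryGroup n ℂ)) =
      Set.range fun p : (n → ZMod 4) × Equiv.Perm n => phaseU (.ofAdd p.1) * permU p.2 := by
    ext U
    simp [monomialGroup]
  have hfin := Set.finite_range
    fun p : (n → ZMod 4) × Equiv.Perm n => phaseU (.ofAdd p.1) * permU p.2
  rw [← this] at hfin
  exact hfin.to_subtype

theorem S_eq : S = phaseU (.ofAdd ![0, 1]) := by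
  ext i j
  fin_cases i <;> fin_cases j <;> simp [S, diagU, phaseU_apply, iPow_one, iPow_zero]

theorem S_mem_monomialGroup : S ∈ monomialGroup (Fin 2) :=
  S_eq ▸ phaseU_mem_monomialGroup _

theorem isScaled_S : IsScaled 0 !![1, 0; 0, ⟨0, 1⟩] S := by
  rw [S_eq]
  convert isScaled_phaseU ![0, 1] using 1
  decide

/-- The single-qubit Clifford group, generated by `K`, `S` and the scalar `i`. -/
def clifford1 : Subgroup (Matrix.unitaryGroup (Fin 2) ℂ) :=
  Subgroup.closure {K, S, phaseU (.ofAdd fun _ => 1)}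

theorem K_mem_clifford1 : K ∈ clifford1 := Subgroup.subset_closure (by simp)
theorem S_mem_clifford1 : S ∈ clifford1 := Subgroup.subset_closure (by simp)

theorem monomialGroup_le_clifford1 : monomialGroup (Fin 2) ≤ clifford1 := by
  have hi : phaseU (.ofAdd fun _ => 1) ∈ clifford1 := Subgroup.subset_closure (by simp)
  have hphase : ∀ d : Fin 2 → ZMod 4, phaseU (.ofAdd d) ∈ clifford1 := by
    intro d
    have hd : ∀ d : Fin 2 → ZMod 4,
        d = (d 0).val • (fun _ => (1 : ZMod 4)) + (d 1 - d 0).val • ![0, 1] := by decide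
    rw [hd d, ofAdd_add, ofAdd_nsmul, ofAdd_nsmul, map_mul, map_pow, map_pow, ← S_eq]
    exact mul_mem (pow_mem hi _) (pow_mem S_mem_clifford1 _)
  have hswap : permU (Equiv.swap 0 1) ∈ clifford1 := by
    have := K_mul_phaseU_mul_K True (d := ![0, 2]) (by decide)
    rw [if_pos trivial] at this
    rw [← this]
    exact mul_mem (mul_mem (mul_mem K_mem_clifford1 (hphase _)) K_mem_clifford1) hi
  rintro _ ⟨d, σ, rfl⟩
  refine mul_mem (hphase d) ?_
  have hσ : ∀ σ : Equiv.Perm (Fin 2), σ = 1 ∨ σ = Equiv.swap 0 1 := by decide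
  rcases hσ σ with rfl | rfl
  · rw [map_one]
    exact one_mem _
  · exact hswap

/-- Representatives of the three left cosets of the monomial matrices in the single-qubit Clifford
group. -/
def cliffordRep : Fin 3 → Matrix.unitaryGroup (Fin 2) ℂ := ![1, K, S * K]

theorem cliffordRep_mem (s : Fin 3) : cliffordRep s ∈ clifford1 := by
  fin_cases s
  exacts [one_mem _, K_mem_clifford1, mul_mem S_mem_clifford1 K_mem_clifford1]

/-- A monomial matrix has a zero in each column. -/
theorem IsScaled.notMem_monomialGroup {k : ℕ} {A : Matrix (Fin 2) (Fin 2) GaussianInt}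
    {U : Matrix.unitaryGroup (Fin 2) ℂ} (h : IsScaled k A U) (h0 : A 0 0 ≠ 0) (h1 : A 1 0 ≠ 0) :
    U ∉ monomialGroup (Fin 2) := by
  rintro ⟨d, σ, rfl⟩
  have key : ∀ i, A i 0 ≠ 0 → i = σ 0 := by
    intro i hi
    by_contra hne
    have := congrFun (congrFun h i) 0
    have h0 : GaussianInt.toComplex (A i 0) = 0 := by
      simpa [Matrix.mul_apply, phaseU_apply, permU_apply, hne] using this.symm
    exact hi (GaussianInt.toComplex_eq_zero.1 h0)
  exact absurd ((key 0 h0).trans (key 1 h1).symm) (by decide)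

theorem K_inv : K⁻¹ = K * phaseU (.ofAdd fun _ => 1) := by
  have := K_mul_phaseU_mul_K False (d := 0) (by simp)
  rw [inv_eq_iff_mul_eq_one, ← mul_assoc]
  simpa using this

theorem cliffordRep_eq_of_mem {s t : Fin 3}
    (h : (cliffordRep s)⁻¹ * cliffordRep t ∈ monomialGroup (Fin 2)) : s = t := by
  have hK : K ∉ monomialGroup (Fin 2) := isScaled_K.notMem_monomialGroup (by decide) (by decide)
  have hSK : S * K ∉ monomialGroup (Fin 2) :=
    (isScaled_S.mul isScaled_K).notMem_monomialGroup (by decide) (by decide)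
  have hKSK : K⁻¹ * (S * K) ∉ monomialGroup (Fin 2) := by
    rw [K_inv]
    exact ((isScaled_K.mul (isScaled_phaseU _)).mul
      (isScaled_S.mul isScaled_K)).notMem_monomialGroup (by decide) (by decide)
  have hKSK' : (S * K)⁻¹ * K ∉ monomialGroup (Fin 2) := by
    rw [← inv_mem_iff]
    simpa using hKSK
  fin_cases s <;> fin_cases t <;> simp [cliffordRep, -mul_inv_rev] at h ⊢
  exacts [hK h, hSK h, hK h, hKSK h, hSK h, hKSK' h]

theorem cliffordRep_eq_of_mul_eq {s t : Fin 3} {m m' : Matrix.unitaryGroup (Fin 2) ℂ}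
    (hm : m ∈ monomialGroup (Fin 2)) (hm' : m' ∈ monomialGroup (Fin 2))
    (h : cliffordRep s * m = cliffordRep t * m') : s = t := by
  refine cliffordRep_eq_of_mem ?_
  rw [show (cliffordRep s)⁻¹ * cliffordRep t = m * m'⁻¹ by
    rw [inv_mul_eq_iff_eq_mul, ← mul_assoc, h, mul_inv_cancel_right]]
  exact mul_mem hm (inv_mem hm')

/-- Left multiplication by `K`, `S` and `i` permutes the three cosets of the monomial matrices. -/
theorem isNormalForm_clifford1 :
    IsNormalForm (fun p : Fin 3 × monomialGroup (Fin 2) => cliffordRep p.1 * p.2.1) clifford1 := by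
  refine isNormalForm_closure ?_ ?_ ⟨(0, 1), by simp [cliffordRep]⟩ ?_
  · rintro ⟨s, m⟩ ⟨t, m'⟩ h
    obtain rfl := cliffordRep_eq_of_mul_eq m.2 m'.2 h
    simpa using h
  · rintro ⟨s, m⟩
    exact mul_mem (cliffordRep_mem s) (monomialGroup_le_clifford1 m.2)
  · intro g hg
    suffices h : ∀ s, ∃ t d σ, cliffordRep t * (phaseU (.ofAdd d) * permU σ) =
        g * cliffordRep s by
      rintro ⟨s, m⟩
      obtain ⟨t, d, σ, h⟩ := h s
      refine ⟨(t, ⟨_, d, σ, rfl⟩ * m), ?_⟩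
      simp only [Subgroup.coe_mul]
      rw [← mul_assoc, h, mul_assoc]
    intro s
    rcases hg with rfl | rfl | rfl
    · fin_cases s
      · exact ⟨1, 0, 1, by simp [cliffordRep]⟩
      · exact ⟨0, fun _ => 3, 1, (isScaled_one.mul
          ((isScaled_phaseU _).mul (isScaled_permU _))).eq (isScaled_K.mul isScaled_K)
          (by decide)⟩
      · exact ⟨2, ![3, 0], Equiv.swap 0 1, ((isScaled_S.mul isScaled_K).mul
          ((isScaled_phaseU _).mul (isScaled_permU _))).eq
          (isScaled_K.mul (isScaled_S.mul isScaled_K)) (by decide)⟩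
    · fin_cases s
      · exact ⟨0, ![0, 1], 1, by simp [cliffordRep, S_eq]⟩
      · exact ⟨2, 0, 1, by simp [cliffordRep]⟩
      · exact ⟨1, 0, Equiv.swap 0 1, (isScaled_K.mul
          ((isScaled_phaseU _).mul (isScaled_permU _))).eq
          (isScaled_S.mul (isScaled_S.mul isScaled_K)) (by decide)⟩
    · refine ⟨s, fun _ => 1, 1, ?_⟩
      ext i j
      simp [Matrix.mul_apply, phaseU_apply, mul_comm]

theorem exists_cliffordRep {U : Matrix.unitaryGroup (Fin 2) ℂ} (hU : U ∈ clifford1) :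
    ∃ s, (cliffordRep s)⁻¹ * U ∈ monomialGroup (Fin 2) := by
  obtain ⟨⟨s, m⟩, rfl⟩ := isNormalForm_clifford1.exists_eq hU
  exact ⟨s, by simp⟩

/-! ### The group generated by `K₀` and the diagonal gates -/

/-- Relabelling the values of the control qubits permutes the blocks. -/
theorem permU_mul_blockU {σ : Equiv.Perm Basis3} {ρ : Equiv.Perm (Fin 2 × Fin 2)}
    (h : ∀ a c, σ (target0 (a, c)) = target0 (a, ρ c))
    (f : Fin 2 × Fin 2 → Matrix.unitaryGroup (Fin 2) ℂ) :
    permU σ * blockU target0 f = blockU target0 (fun c => f (ρ⁻¹ c)) * permU σ := by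
  have hσ : ∀ x, σ⁻¹ (target0 x) = target0 (x.1, ρ⁻¹ x.2) := by
    rintro ⟨a, c⟩
    rw [Equiv.Perm.inv_eq_iff_eq, h]
    simp
  refine eq_of_apply_equiv target0 fun x y => ?_
  have h1 : (permU σ * blockU target0 f).1 (target0 x) (target0 y) =
      (blockU target0 f).1 (σ⁻¹ (target0 x)) (target0 y) := by
    simp [Matrix.mul_apply, permU_apply, ← Equiv.Perm.inv_eq_iff_eq]
  have h2 : (blockU target0 (fun c => f (ρ⁻¹ c)) * permU σ).1 (target0 x) (target0 y) =
      (blockU target0 (fun c => f (ρ⁻¹ c))).1 (target0 x) (σ (target0 y)) := by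
    simp [Matrix.mul_apply, permU_apply]
  obtain ⟨b, c⟩ := y
  rw [h1, h2, hσ, h, blockU_apply, blockU_apply]
  simp only [Equiv.Perm.inv_eq_iff_eq]

/-- The squared total determinant of a family of blocks. -/
def detSq : (Fin 2 × Fin 2 → Matrix.unitaryGroup (Fin 2) ℂ) →* ℂ where
  toFun f := ∏ c, (f c).1.det ^ 2
  map_one' := by simp
  map_mul' f g := by simp [mul_pow, Finset.prod_mul_distrib]

theorem detSq_apply (f : Fin 2 × Fin 2 → Matrix.unitaryGroup (Fin 2) ℂ) :
    detSq f = ∏ c, (f c).1.det ^ 2 := rfl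

/-- Families of single-qubit Clifford blocks whose total determinant is `1` or `-1`. -/
def blockGroup : Subgroup (Fin 2 × Fin 2 → Matrix.unitaryGroup (Fin 2) ℂ) :=
  Subgroup.pi Set.univ (fun _ => clifford1) ⊓ detSq.ker

theorem mem_blockGroup {f : Fin 2 × Fin 2 → Matrix.unitaryGroup (Fin 2) ℂ} :
    f ∈ blockGroup ↔ (∀ c, f c ∈ clifford1) ∧ detSq f = 1 := by
  simp [blockGroup, Subgroup.mem_inf, Subgroup.mem_pi, MonoidHom.mem_ker]

theorem det_phaseU (d : Fin 2 → ZMod 4) :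
    (phaseU (.ofAdd d)).1.det = iPow (d 0 + d 1) := by
  rw [Matrix.det_fin_two, iPow_add]
  simp [phaseU_apply]

theorem det_permU_sq (σ : Equiv.Perm (Fin 2)) : (permU σ).1.det ^ 2 = 1 := by
  have hσ : ∀ σ : Equiv.Perm (Fin 2), σ = 1 ∨ σ = Equiv.swap 0 1 := by decide
  rcases hσ σ with rfl | rfl
  · simp
  · rw [Matrix.det_fin_two]
    simp [permU_apply]

theorem det_K : K.1.det = Complex.I := by
  have h := congrArg Matrix.det isScaled_K
  rw [Matrix.det_smul, Matrix.det_fin_two (Matrix.map _ _)] at h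
  simp at h
  have h2 : (1 + Complex.I) ^ 2 = 2 * Complex.I := by
    linear_combination Complex.I_sq
  rw [h2] at h
  have h3 := Complex.I_mul_I
  linear_combination (-Complex.I / 2) * h + K.1.det * h3

theorem det_S : S.1.det = Complex.I := by
  rw [S_eq, det_phaseU]
  simp [iPow_one]

theorem detSq_phaseU (d : Fin 2 × Fin 2 → Fin 2 → ZMod 4) :
    detSq (fun c => phaseU (.ofAdd (d c))) = iPow (2 * ∑ c, (d c 0 + d c 1)) := by
  simp only [detSq_apply, det_phaseU, Fintype.prod_prod_type, Fin.prod_univ_two,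
    Fintype.sum_prod_type, Fin.sum_univ_two, two_mul, iPow_add]
  ring

/-! ### The factors of the normal form as block matrices -/

/-- The family of blocks of `e₄ s`. -/
def blocksE4 (s : Fin 3) (_ : Fin 2 × Fin 2) : Matrix.unitaryGroup (Fin 2) ℂ := cliffordRep s

/-- A Clifford representative on the blocks selected by `p`; the uncontrolled gate `S₀` of the last
representative also acts on the other blocks. -/
def blocksCtrl (p : Fin 2 × Fin 2 → Prop) [DecidablePred p] (s : Fin 3) (c : Fin 2 × Fin 2) :
    Matrix.unitaryGroup (Fin 2) ℂ :=
  if p c then cliffordRep s else (![1, 1, S] : Fin 3 → _) s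

/-- The doubly controlled powers of `K' = K S†`. -/
def blocksE1 (s : Fin 3) (c : Fin 2 × Fin 2) : Matrix.unitaryGroup (Fin 2) ℂ :=
  if c = (1, 1) then (K * phaseU (.ofAdd ![0, 3])) ^ (s : ℕ) else 1

theorem CK10_eq : CK10 = blockU target0 fun c => if c.1 = 1 then K else 1 := by
  rw [CK10, K0_eq, CS01_eq, S1_eq, iG_eq]
  simp only [phaseU_eq_blockU target0, ← map_pow, ← map_mul]
  congr 1
  funext c
  simp only [Pi.mul_apply, Pi.pow_apply]
  have hs := fun d₁ d₂ d₃ d₄ => (((((isScaled_phaseU d₁).mul isScaled_K).mul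
    (isScaled_phaseU d₂)).mul (isScaled_K.mul ((isScaled_phaseU d₃).pow 3))).mul
    (isScaled_phaseU d₁)).mul (isScaled_phaseU d₄)
  obtain ⟨b, c⟩ := c
  rcases (by decide : ∀ b : Fin 2, b = 0 ∨ b = 1) b with rfl | rfl
  · rw [if_neg zero_ne_one]
    exact (hs _ _ _ _).eq isScaled_one (by decide +revert)
  · rw [if_pos rfl]
    exact (hs _ _ _ _).eq isScaled_K (by decide +revert)

theorem CK20_eq : CK20 = blockU target0 fun c => if c.2 = 1 then K else 1 := by
  have hρ : ∀ a c, permSwap12 (target0 (a, c)) = target0 (a, Equiv.prodComm (Fin 2) (Fin 2) c) := by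
    decide
  rw [CK20, Swap12_eq, CK10_eq, permU_mul_blockU hρ, mul_assoc, ← map_mul permU,
    show permSwap12 * permSwap12 = 1 by decide, map_one, mul_one]
  rfl

theorem CCX0_eq_blockU : CCX0 = blockU target0 fun c =>
    permU (if c.1 = 1 ∧ c.2 = 1 then Equiv.swap 0 1 else 1) := by
  rw [CCX0_eq]
  exact permU_eq_blockU target0 (by decide)

theorem CX10_eq_blockU : CX10 = blockU target0 fun c =>
    permU (if c.1 = 1 then Equiv.swap 0 1 else 1) := by
  rw [CX10_eq]
  exact permU_eq_blockU target0 (by decide)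

theorem CCK0_eq : CCK0 = blockU target0 fun c =>
    if c = (1, 1) then K * phaseU (.ofAdd ![0, 3]) else 1 := by
  rw [CCK0, CZ12, CZ02, CCX0_eq_blockU, CX10_eq_blockU, K0_eq, CS01_eq, CS12_eq, CS02_eq, iG_eq]
  simp only [phaseU_eq_blockU target0, ← map_pow, ← map_mul]
  congr 1
  funext c
  simp only [Pi.mul_apply, Pi.pow_apply]
  have hK := isScaled_K
  have hs := fun d₁ d₂ σ τ d₃ d₄ =>
    ((((((((((((hK.mul (isScaled_phaseU d₁)).mul hK).mul (isScaled_phaseU d₂)).mul hK).mul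
      (isScaled_phaseU d₁)).mul hK).mul (isScaled_permU σ)).mul (isScaled_permU τ)).mul
      (isScaled_phaseU d₃)).mul ((isScaled_phaseU d₃).mul (isScaled_phaseU d₃))).mul
      (isScaled_phaseU d₂)).mul ((isScaled_phaseU d₂).mul (isScaled_phaseU d₂))).mul
      ((isScaled_phaseU d₄).pow 2)
  have hc : ∀ c : Fin 2 × Fin 2, c = (0, 0) ∨ c = (0, 1) ∨ c = (1, 0) ∨ c = (1, 1) := by decide
  rcases hc c with rfl | rfl | rfl | rfl
  · rw [if_neg (c := (0, 0) = (1, 1)) (by decide)]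
    exact (hs _ _ _ _ _ _).eq isScaled_one (by decide +kernel)
  · rw [if_neg (c := (0, 1) = (1, 1)) (by decide)]
    exact (hs _ _ _ _ _ _).eq isScaled_one (by decide +kernel)
  · rw [if_neg (c := (1, 0) = (1, 1)) (by decide)]
    exact (hs _ _ _ _ _ _).eq isScaled_one (by decide +kernel)
  · rw [if_pos rfl]
    exact (hs _ _ _ _ _ _).eq (hK.mul (isScaled_phaseU _)) (by decide +kernel)

theorem S0_eq_blockU : S0 = blockU target0 fun _ => S := by
  rw [S0_eq, phaseU_eq_blockU target0, S_eq]
  congr 1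
  funext c
  congr 2
  decide +revert

theorem e4_eq (s : Fin 3) : e4 s = blockU target0 (blocksE4 s) := by
  fin_cases s
  · exact (map_one _).symm
  · exact K0_eq
  · change S0 * K0 = _
    rw [S0_eq_blockU, K0_eq, ← map_mul]
    rfl

/-- The common shape of `e₂` and `e₃`. -/
theorem ctrl_eq (p : Fin 2 × Fin 2 → Prop) [DecidablePred p] (s : Fin 3) :
    (![1, blockU target0 fun c => if p c then K else 1,
      S0 * blockU target0 fun c => if p c then K else 1] : Fin 3 → U8) s =
      blockU target0 (blocksCtrl p s) := by
  fin_cases s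
  · change 1 = _
    rw [← map_one (blockU target0)]
    congr 1
    funext c
    simp [blocksCtrl, cliffordRep]
  · rfl
  · change S0 * blockU target0 _ = _
    rw [S0_eq_blockU, ← map_mul]
    congr 1
    funext c
    simp only [blocksCtrl, cliffordRep, Pi.mul_apply]
    split_ifs
    · rfl
    · exact mul_one S

theorem e3_eq (s : Fin 3) : e3 s = blockU target0 (blocksCtrl (fun c => c.2 = 1) s) := by
  rw [e3, CK20_eq, ctrl_eq]

theorem e2_eq (s : Fin 3) : e2 s = blockU target0 (blocksCtrl (fun c => c.1 = 1) s) := by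
  rw [e2, CK10_eq, ctrl_eq]

theorem e1_eq (s : Fin 3) : e1 s = blockU target0 (blocksE1 s) := by
  rw [e1, CCK0_eq]
  have h : ∀ s : Fin 3, blocksE1 s =
      (fun c => if c = (1, 1) then K * phaseU (.ofAdd ![0, 3]) else 1) ^ (s : ℕ) := by
    intro s
    funext c
    simp only [blocksE1, Pi.pow_apply, ite_pow, one_pow]
  rw [h, map_pow]
  fin_cases s
  exacts [(pow_zero _).symm, (pow_one _).symm, (pow_two _).symm]

theorem nfE_eq (a : IdxE) : nfE a = blockU target0 (blocksE4 a.1 *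
    blocksCtrl (fun c => c.2 = 1) a.2.1 * blocksCtrl (fun c => c.1 = 1) a.2.2.1 *
    blocksE1 a.2.2.2) := by
  obtain ⟨s4, s3, s2, s1⟩ := a
  simp only [nfE, e4_eq, e3_eq, e2_eq, e1_eq, map_mul]

/-- Up to a monomial matrix on the right, `K'` and `K'²` are the representatives `K` and `S K`. -/
theorem exists_pow_eq_cliffordRep_mul (s : Fin 3) : ∃ m ∈ monomialGroup (Fin 2),
    (K * phaseU (.ofAdd ![0, 3])) ^ (s : ℕ) = cliffordRep s * m := by
  fin_cases s
  · exact ⟨1, one_mem _, by simp [cliffordRep]⟩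
  · exact ⟨phaseU (.ofAdd ![0, 3]), phaseU_mem_monomialGroup _, by simp [cliffordRep]⟩
  · refine ⟨phaseU (.ofAdd ![3, 3]) * permU 1,
      mul_mem (phaseU_mem_monomialGroup _) (permU_mem_monomialGroup _), ?_⟩
    exact ((isScaled_K.mul (isScaled_phaseU _)).pow 2).eq ((isScaled_S.mul isScaled_K).mul
      ((isScaled_phaseU _).mul (isScaled_permU _))) (by decide)

/-! ### The normal form of the group generated by `K₀` and the diagonal gates -/

theorem blocksE4_mem (s : Fin 3) : blocksE4 s ∈ blockGroup := by
  refine mem_blockGroup.2 ⟨fun c => cliffordRep_mem s, ?_⟩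
  rw [detSq_apply]
  fin_cases s <;>
    norm_num [blocksE4, cliffordRep, det_K, det_S, mul_pow]

theorem blocksCtrl_mem_clifford1 (p : Fin 2 × Fin 2 → Prop) [DecidablePred p] (s : Fin 3)
    (c : Fin 2 × Fin 2) : blocksCtrl p s c ∈ clifford1 := by
  unfold blocksCtrl
  split_ifs
  · exact cliffordRep_mem s
  · fin_cases s
    exacts [one_mem _, one_mem _, S_mem_clifford1]

theorem blocksCtrl_mem_monomialGroup {p : Fin 2 × Fin 2 → Prop} [DecidablePred p] (s : Fin 3)
    {c : Fin 2 × Fin 2} (hc : ¬ p c) : blocksCtrl p s c ∈ monomialGroup (Fin 2) := by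
  rw [blocksCtrl, if_neg hc]
  fin_cases s
  exacts [one_mem _, one_mem _, S_mem_monomialGroup]

theorem blocksE3_mem (s : Fin 3) : blocksCtrl (fun c => c.2 = 1) s ∈ blockGroup := by
  refine mem_blockGroup.2 ⟨blocksCtrl_mem_clifford1 _ s, ?_⟩
  rw [detSq_apply]
  fin_cases s <;>
    simp [blocksCtrl, cliffordRep, Fintype.prod_prod_type, det_K, det_S]

theorem blocksE2_mem (s : Fin 3) : blocksCtrl (fun c => c.1 = 1) s ∈ blockGroup := by
  refine mem_blockGroup.2 ⟨blocksCtrl_mem_clifford1 _ s, ?_⟩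
  rw [detSq_apply]
  fin_cases s <;>
    simp [blocksCtrl, cliffordRep, Fintype.prod_prod_type, det_K, det_S]

theorem blocksE1_mem (s : Fin 3) : blocksE1 s ∈ blockGroup := by
  have h : ∀ m ∈ monomialGroup (Fin 2), m ∈ clifford1 := fun m hm => monomialGroup_le_clifford1 hm
  refine mem_blockGroup.2 ⟨fun c => ?_, ?_⟩
  · unfold blocksE1
    split_ifs
    · exact pow_mem (mul_mem K_mem_clifford1 (h _ (phaseU_mem_monomialGroup _))) _
    · exact one_mem _
  · have hdet : (K * phaseU (.ofAdd ![0, 3])).1.det = 1 := by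
      rw [Matrix.UnitaryGroup.mul_val, Matrix.det_mul, det_K, det_phaseU, ← iPow_one, ← iPow_add]
      exact iPow_zero
    have hdet' : ((K * phaseU (.ofAdd ![0, 3])) ^ (s : ℕ)).1.det = 1 := by
      rw [SubmonoidClass.coe_pow, Matrix.det_pow, hdet, one_pow]
    rw [detSq_apply]
    refine Finset.prod_eq_one fun c _ => ?_
    unfold blocksE1
    split_ifs
    · rw [hdet', one_pow]
    · simp

/-- Block diagonal matrices with monomial blocks and total determinant `1` or `-1` lie in `QD`. -/
theorem blockU_mem_QD {f : Fin 2 × Fin 2 → Matrix.unitaryGroup (Fin 2) ℂ}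
    (hf : ∀ c, f c ∈ monomialGroup (Fin 2)) (hdet : detSq f = 1) : blockU target0 f ∈ QD := by
  choose d τ h using hf
  obtain rfl : f = (fun c => phaseU (.ofAdd (d c))) * fun c => permU (τ c) :=
    funext fun c => (h c).symm
  have hτ : ∀ τ : Fin 2 × Fin 2 → Equiv.Perm (Fin 2), ∃ p : IdxQ, ∀ a c,
      permNfQ p (target0 (a, c)) = target0 (τ c a, c) := by decide +kernel
  obtain ⟨p, hp⟩ := hτ τ
  rw [map_mul, ← permU_eq_blockU target0 hp, ← nfQ_eq]
  refine mul_mem ?_ ?_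
  · refine isSemidirect_QD.2.1 ?_
    rw [D_eq_map]
    have hd := phaseU_eq_blockU target0 fun x => d x.2 x.1
    refine ⟨_, ?_, hd⟩
    rw [SetLike.mem_coe, ofAdd_mem_evenPhase]
    have hperm : detSq (fun c => permU (τ c)) = 1 := by
      rw [detSq_apply]
      exact Finset.prod_eq_one fun c _ => det_permU_sq (τ c)
    rw [map_mul, hperm, mul_one, detSq_phaseU, ← iPow_zero] at hdet
    rw [← iPow_injective hdet]
    congr 1
    rw [Fintype.sum_prod_type_right]
    simp only [Fin.sum_univ_two]
  · exact isSemidirect_QD.1 (isNormalForm_nfQ.1 p)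

theorem QD_le_map : QD ≤ (Subgroup.pi Set.univ fun _ => monomialGroup (Fin 2)).map
    (blockU target0) := by
  have hQ : ∀ p : IdxQ, ∃ τ : Fin 2 × Fin 2 → Equiv.Perm (Fin 2), ∀ a c,
      permNfQ p (target0 (a, c)) = target0 (τ c a, c) := by decide +kernel
  rw [QD_eq_sup, sup_le_iff]
  constructor
  · intro g hg
    obtain ⟨p, rfl⟩ := isNormalForm_nfQ.exists_eq hg
    obtain ⟨τ, hτ⟩ := hQ p
    rw [nfQ_eq, permU_eq_blockU target0 hτ]
    exact ⟨_, fun c _ => permU_mem_monomialGroup _, rfl⟩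
  · rw [D_eq_map]
    rintro _ ⟨d, -, rfl⟩
    rw [show d = .ofAdd d.toAdd from rfl, phaseU_eq_blockU target0]
    exact ⟨_, fun c _ => phaseU_mem_monomialGroup _, rfl⟩

/-- All generators have Clifford blocks with total determinant `±1`: the four blocks `K` of `K₀`
have total determinant `1`, and the parity condition of `D` takes care of the diagonal gates. -/
theorem K0D_le_map_blockGroup : K0D ≤ blockGroup.map (blockU target0) := by
  rw [K0D, Subgroup.closure_union, sup_le_iff]
  constructor
  · rw [Subgroup.closure_le]
    rintro _ rfl
    exact ⟨_, blocksE4_mem 1, K0_eq.symm⟩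
  · change D ≤ _
    rw [D_eq_map]
    rintro _ ⟨d, hd, rfl⟩
    rw [show d = .ofAdd d.toAdd from rfl, phaseU_eq_blockU target0]
    refine ⟨_, mem_blockGroup.2 ⟨fun c => monomialGroup_le_clifford1
      (phaseU_mem_monomialGroup _), ?_⟩, rfl⟩
    rw [detSq_phaseU fun c a => d.toAdd (target0 (a, c)), ← iPow_zero,
      ← show 2 * ∑ j, d.toAdd j = 0 from hd]
    congr 2
    have hsum := Fintype.sum_prod_type_right d.toAdd
    simp only [Fin.sum_univ_two] at hsum
    exact hsum.symm

theorem K0_mem_K0D : K0 ∈ K0D := Subgroup.subset_closure (Set.mem_union_left _ rfl)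

theorem D_le_K0D : D ≤ K0D := Subgroup.closure_mono Set.subset_union_right

theorem Q_le_K0D : Q ≤ K0D := by
  have hmem : ∀ {g}, g ∈ genD → g ∈ K0D := fun h => D_le_K0D (Subgroup.subset_closure h)
  have hK := K0_mem_K0D
  have hi : iG ∈ K0D := hmem (by simp [genD])
  have h1 : S0 ∈ K0D := hmem (by simp [genD])
  have h2 : CS01 ∈ K0D := hmem (by simp [genD])
  have h3 : CS02 ∈ K0D := hmem (by simp [genD])
  have h4 : CCZ ∈ K0D := hmem (by simp [genD])
  rw [Q, Subgroup.closure_le]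
  rintro g (rfl | rfl | rfl | rfl)
  · exact mul_mem (mul_mem (mul_mem (mul_mem hK h1) h1) hK) hi
  · exact mul_mem (mul_mem (mul_mem (mul_mem hK h2) h2) hK) hi
  · exact mul_mem (mul_mem (mul_mem (mul_mem hK h3) h3) hK) hi
  · exact mul_mem (mul_mem (mul_mem hK h4) hK) hi

theorem QD_le_K0D : QD ≤ K0D := by
  rw [QD_eq_sup]
  exact sup_le Q_le_K0D D_le_K0D

/-- The gates of `C` act on the two control qubits only. -/
theorem exists_control_perm (p : IdxC) : ∃ ρ : Equiv.Perm (Fin 2 × Fin 2), ∀ a c,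
    permNfC p (target0 (a, c)) = target0 (a, ρ c) := by
  revert p
  decide +kernel

theorem C_conj_K0D {a g : U8} (ha : a ∈ C) (hg : g ∈ K0D) : a * g * a⁻¹ ∈ K0D := by
  refine conj_mem_closure ?_ ha hg
  rintro a ha b (rfl | hb)
  · obtain ⟨p, rfl⟩ := isNormalForm_nfC.exists_eq ha
    obtain ⟨ρ, hρ⟩ := exists_control_perm p
    rw [nfC_eq, K0_eq, permU_mul_blockU hρ, mul_inv_cancel_right, ← K0_eq]
    exact K0_mem_K0D
  · exact D_le_K0D (P_conj_D (C_le_P ha) (Subgroup.subset_closure hb))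

/-- A permutation of the blocks that is itself block diagonal is trivial. -/
theorem C_inf_K0D : C ⊓ K0D = ⊥ := by
  rw [eq_bot_iff]
  rintro g ⟨hC, hK⟩
  obtain ⟨p, rfl⟩ := isNormalForm_nfC.exists_eq hC
  obtain ⟨ρ, hρ⟩ := exists_control_perm p
  obtain ⟨f, -, hf⟩ := K0D_le_map_blockGroup hK
  have hone : permNfC p = 1 := by
    ext1 x
    obtain ⟨a, c⟩ := x
    have h := congrArg (fun U : U8 => U.1 (target0 (a, ρ c)) (target0 (a, c))) hf
    simp only [blockU_apply, nfC_eq, permU_apply, hρ, if_true] at h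
    by_cases hc : ρ c = c
    · exact (hρ a c).trans (congrArg (fun c => target0 (a, c)) hc)
    · rw [if_neg hc] at h
      exact absurd h zero_ne_one
  rw [nfC_eq, hone, map_one]
  exact one_mem _

theorem CK10_mem_K0D : CK10 ∈ K0D := by
  have hmem : ∀ {g}, g ∈ genD → g ∈ K0D := fun h => D_le_K0D (Subgroup.subset_closure h)
  have hK := K0_mem_K0D
  have hi : iG ∈ K0D := hmem (by simp [genD])
  have h1 : S1 ∈ K0D := hmem (by simp [genD])
  have h2 : CS01 ∈ K0D := hmem (by simp [genD])
  exact mul_mem (mul_mem (mul_mem (mul_mem (mul_mem h2 hK) h2) (mul_mem hK (pow_mem h1 _))) h2) hi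

theorem Swap12_mem_C : Swap12 ∈ C := by
  have h1 : CX12 ∈ C := Subgroup.subset_closure (by simp [genC])
  have h2 : CX21 ∈ C := Subgroup.subset_closure (by simp [genC])
  exact mul_mem (mul_mem h1 h2) h1

theorem CK20_mem_K0D : CK20 ∈ K0D := by
  have h := C_conj_K0D Swap12_mem_C CK10_mem_K0D
  have hinv : Swap12⁻¹ = Swap12 := by
    rw [Swap12_eq, ← map_inv, show permSwap12⁻¹ = permSwap12 by decide]
  rwa [hinv] at h

theorem CCK0_mem_K0D : CCK0 ∈ K0D := by
  have hmem : ∀ {g}, g ∈ genD → g ∈ K0D := fun h => D_le_K0D (Subgroup.subset_closure h)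
  have hK := K0_mem_K0D
  have hi : iG ∈ K0D := hmem (by simp [genD])
  have h01 : CS01 ∈ K0D := hmem (by simp [genD])
  have h12 : CS12 ∈ K0D := hmem (by simp [genD])
  have h02 : CS02 ∈ K0D := hmem (by simp [genD])
  have hCCX : CCX0 ∈ K0D := Q_le_K0D (Subgroup.subset_closure (by simp [genQ]))
  have hCX : CX10 ∈ K0D := Q_le_K0D (Subgroup.subset_closure (by simp [genQ]))
  exact mul_mem (mul_mem (mul_mem (mul_mem (mul_mem (mul_mem (mul_mem (mul_mem (mul_mem (mul_mem
    (mul_mem (mul_mem (mul_mem hK h01) hK) h02) hK) h01) hK) hCCX) hCX) h12) (mul_mem h12 h12))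
    h02) (mul_mem h02 h02)) (pow_mem hi _)

theorem nfE_mem_K0D (a : IdxE) : nfE a ∈ K0D := by
  have hS : S0 ∈ K0D := D_le_K0D (Subgroup.subset_closure (by simp [genD]))
  obtain ⟨s4, s3, s2, s1⟩ := a
  refine mul_mem (mul_mem (mul_mem ?_ ?_) ?_) ?_
  · fin_cases s4
    exacts [one_mem _, K0_mem_K0D, mul_mem hS K0_mem_K0D]
  · fin_cases s3
    exacts [one_mem _, CK20_mem_K0D, mul_mem hS CK20_mem_K0D]
  · fin_cases s2
    exacts [one_mem _, CK10_mem_K0D, mul_mem hS CK10_mem_K0D]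
  · fin_cases s1
    exacts [one_mem _, CCK0_mem_K0D, mul_mem CCK0_mem_K0D CCK0_mem_K0D]

/-- Every element of the block group is `nfE a` times an element with monomial blocks: `e₄` makes
the block at `(0, 0)` monomial, then `e₃` the block at `(0, 1)`, `e₂` the block at `(1, 0)` and `e₁`
the block at `(1, 1)`, each without spoiling the blocks already treated. -/
theorem exists_nfE_inv_mul_mem_QD {f : Fin 2 × Fin 2 → Matrix.unitaryGroup (Fin 2) ℂ}
    (hf : f ∈ blockGroup) : ∃ a, (nfE a)⁻¹ * blockU target0 f ∈ QD := by
  -- In what follows `f1`, …, `f4` are the blocks after removing `e₄`, …, `e₁` on the left.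
  obtain ⟨s4, h4⟩ := exists_cliffordRep ((mem_blockGroup.1 hf).1 (0, 0))
  have hf1 := mul_mem (inv_mem (blocksE4_mem s4)) hf
  set f1 := (blocksE4 s4)⁻¹ * f
  have m00 : f1 (0, 0) ∈ monomialGroup (Fin 2) := h4
  obtain ⟨s3, h3⟩ := exists_cliffordRep ((mem_blockGroup.1 hf1).1 (0, 1))
  have hf2 := mul_mem (inv_mem (blocksE3_mem s3)) hf1
  set f2 := (blocksCtrl (fun c => c.2 = 1) s3)⁻¹ * f1
  replace m00 : f2 (0, 0) ∈ monomialGroup (Fin 2) :=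
    mul_mem (inv_mem (blocksCtrl_mem_monomialGroup s3 (by simp))) m00
  have m01 : f2 (0, 1) ∈ monomialGroup (Fin 2) := h3
  obtain ⟨s2, h2⟩ := exists_cliffordRep ((mem_blockGroup.1 hf2).1 (1, 0))
  have hf3 := mul_mem (inv_mem (blocksE2_mem s2)) hf2
  set f3 := (blocksCtrl (fun c => c.1 = 1) s2)⁻¹ * f2
  replace m00 : f3 (0, 0) ∈ monomialGroup (Fin 2) :=
    mul_mem (inv_mem (blocksCtrl_mem_monomialGroup s2 (by simp))) m00
  replace m01 : f3 (0, 1) ∈ monomialGroup (Fin 2) :=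
    mul_mem (inv_mem (blocksCtrl_mem_monomialGroup s2 (by simp))) m01
  have m10 : f3 (1, 0) ∈ monomialGroup (Fin 2) := h2
  obtain ⟨s1, h1⟩ := exists_cliffordRep ((mem_blockGroup.1 hf3).1 (1, 1))
  have hf4 := mul_mem (inv_mem (blocksE1_mem s1)) hf3
  set f4 := (blocksE1 s1)⁻¹ * f3 with hf4_def
  have hne : ∀ c, c ≠ (1, 1) → f4 c = f3 c := by
    intro c hc
    simp [hf4_def, blocksE1, hc]
  have m11 : f4 (1, 1) ∈ monomialGroup (Fin 2) := by
    obtain ⟨m, hm, hms⟩ := exists_pow_eq_cliffordRep_mul s1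
    have : f4 (1, 1) = m⁻¹ * ((cliffordRep s1)⁻¹ * f3 (1, 1)) := by
      simp only [hf4_def, Pi.mul_apply, Pi.inv_apply, blocksE1, if_true, hms]
      rw [mul_inv_rev, mul_assoc]
    rw [this]
    exact mul_mem (inv_mem hm) h1
  have hmono : ∀ c, f4 c ∈ monomialGroup (Fin 2) := by
    have hc : ∀ c : Fin 2 × Fin 2, c = (0, 0) ∨ c = (0, 1) ∨ c = (1, 0) ∨ c = (1, 1) := by decide
    intro c
    rcases hc c with rfl | rfl | rfl | rfl
    · rwa [hne _ (by decide)]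
    · rwa [hne _ (by decide)]
    · rwa [hne _ (by decide)]
    · exact m11
  refine ⟨(s4, s3, s2, s1), ?_⟩
  have : (nfE (s4, s3, s2, s1))⁻¹ * blockU target0 f = blockU target0 f4 := by
    rw [nfE_eq, ← map_inv, ← map_mul]
    simp only [mul_inv_rev, mul_assoc]
    rfl
  rw [this]
  exact blockU_mem_QD hmono (mem_blockGroup.1 hf4).2

/-- The parameters of `nfE` are read off block by block, in the order `(0, 0)`, `(0, 1)`, `(1, 0)`,
`(1, 1)`. -/
theorem nfE_eq_of_mul_eq {a b : IdxE} {g h : U8} (hg : g ∈ QD) (hh : h ∈ QD)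
    (heq : nfE a * g = nfE b * h) : a = b := by
  obtain ⟨f, hf, rfl⟩ := QD_le_map hg
  obtain ⟨f', hf', rfl⟩ := QD_le_map hh
  replace hf : ∀ c, f c ∈ monomialGroup (Fin 2) := fun c => hf c trivial
  replace hf' : ∀ c, f' c ∈ monomialGroup (Fin 2) := fun c => hf' c trivial
  obtain ⟨a4, a3, a2, a1⟩ := a
  obtain ⟨b4, b3, b2, b1⟩ := b
  rw [nfE_eq, nfE_eq, ← map_mul, ← map_mul] at heq
  replace heq := blockU_injective _ heq
  simp only [mul_assoc] at heq
  -- Each factor is monomial on the blocks treated before it.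
  have hE1 : ∀ s c, c ≠ (1, 1) → blocksE1 s c ∈ monomialGroup (Fin 2) := by
    intro s c hc
    rw [blocksE1, if_neg hc]
    exact one_mem _
  have hE2 : ∀ s c, c.1 ≠ 1 → blocksCtrl (fun c => c.1 = 1) s c ∈ monomialGroup (Fin 2) :=
    fun s c hc => blocksCtrl_mem_monomialGroup s hc
  have hE3 : ∀ s c, c.2 ≠ 1 → blocksCtrl (fun c => c.2 = 1) s c ∈ monomialGroup (Fin 2) :=
    fun s c hc => blocksCtrl_mem_monomialGroup s hc
  obtain rfl : a4 = b4 := by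
    have h00 := congrFun heq (0, 0)
    exact cliffordRep_eq_of_mul_eq
      (mul_mem (hE3 _ _ (by decide)) (mul_mem (hE2 _ _ (by decide))
        (mul_mem (hE1 _ _ (by decide)) (hf _))))
      (mul_mem (hE3 _ _ (by decide)) (mul_mem (hE2 _ _ (by decide))
        (mul_mem (hE1 _ _ (by decide)) (hf' _)))) h00
  replace heq := mul_left_cancel heq
  obtain rfl : a3 = b3 := by
    have h01 := congrFun heq (0, 1)
    exact cliffordRep_eq_of_mul_eq
      (mul_mem (hE2 _ _ (by decide)) (mul_mem (hE1 _ _ (by decide)) (hf _)))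
      (mul_mem (hE2 _ _ (by decide)) (mul_mem (hE1 _ _ (by decide)) (hf' _))) h01
  replace heq := mul_left_cancel heq
  obtain rfl : a2 = b2 := by
    have h10 := congrFun heq (1, 0)
    exact cliffordRep_eq_of_mul_eq (mul_mem (hE1 _ _ (by decide)) (hf _))
      (mul_mem (hE1 _ _ (by decide)) (hf' _)) h10
  replace heq := mul_left_cancel heq
  obtain rfl : a1 = b1 := by
    have h11 := congrFun heq (1, 1)
    obtain ⟨m, hm, hms⟩ := exists_pow_eq_cliffordRep_mul a1
    obtain ⟨m', hm', hms'⟩ := exists_pow_eq_cliffordRep_mul b1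
    simp only [Pi.mul_apply, blocksE1, if_true, hms, hms', mul_assoc] at h11
    exact cliffordRep_eq_of_mul_eq (mul_mem hm (hf _)) (mul_mem hm' (hf' _)) h11
  rfl

theorem isNormalForm_nfK0D : IsNormalForm nfK0D K0D := by
  have hDQ : IsNormalForm (fun p : IdxD × IdxQ => nfD p.1 * nfQ p.2) QD :=
    isSemidirect_QD.isNormalForm_mul_comm isNormalForm_nfQ isNormalForm_nfD
  have hassoc : ∀ p, nfK0D p = nfE p.1 * (nfD p.2.1 * nfQ p.2.2) := fun p => mul_assoc _ _ _
  rw [isNormalForm_iff]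
  constructor
  · rintro ⟨a, p⟩ ⟨b, q⟩ h
    rw [hassoc, hassoc] at h
    obtain rfl := nfE_eq_of_mul_eq (hDQ.1 p) (hDQ.1 q) h
    exact congrArg (Prod.mk a) (hDQ.injective (mul_left_cancel h))
  · refine Set.Subset.antisymm ?_ fun g hg => ?_
    · rintro _ ⟨p, rfl⟩
      rw [hassoc]
      exact mul_mem (nfE_mem_K0D _) (QD_le_K0D (hDQ.1 _))
    · obtain ⟨f, hf, rfl⟩ := K0D_le_map_blockGroup hg
      obtain ⟨a, ha⟩ := exists_nfE_inv_mul_mem_QD hf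
      obtain ⟨p, hp⟩ := hDQ.exists_eq ha
      exact ⟨(a, p), by rw [hassoc, hp, mul_inv_cancel_left]⟩

/-! ### Adding the classical gates on the control qubits -/

theorem isSemidirect_K0CD : IsSemidirect K0CD C K0D := by
  have : K0CD = C ⊔ K0D := by
    rw [K0CD, C, K0D, ← Subgroup.closure_union]
    congr 1
    ext
    simp only [Set.mem_union]
    tauto
  rw [this]
  exact isSemidirect_sup (fun a ha g hg => C_conj_K0D ha hg) C_inf_K0D

theorem isNormalForm_nfK0CD : IsNormalForm nfK0CD K0CD :=
  isSemidirect_K0CD.isNormalForm_mul_comm isNormalForm_nfC isNormalForm_nfK0D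

/-! ### The subgroups of the Clifford+CS group -/

theorem K0CD_le_CliffordCS3_and_P_le_CliffordCS3 : K0CD ≤ CliffordCS3 ∧ P ≤ CliffordCS3 := by
  have hmem : ∀ {g}, g ∈ ({iG, K0, K1, K2, S0, S1, S2, CS01, CS12} : Set U8) → g ∈ CliffordCS3 :=
    fun h => Subgroup.subset_closure h
  have hi : iG ∈ CliffordCS3 := hmem (by simp)
  have hK0 : K0 ∈ CliffordCS3 := hmem (by simp)
  have hK1 : K1 ∈ CliffordCS3 := hmem (by simp)
  have hK2 : K2 ∈ CliffordCS3 := hmem (by simp)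
  have hS0 : S0 ∈ CliffordCS3 := hmem (by simp)
  have hS1 : S1 ∈ CliffordCS3 := hmem (by simp)
  have hS2 : S2 ∈ CliffordCS3 := hmem (by simp)
  have h01 : CS01 ∈ CliffordCS3 := hmem (by simp)
  have h12 : CS12 ∈ CliffordCS3 := hmem (by simp)
  have hconj : ∀ {k g}, k ∈ CliffordCS3 → g ∈ CliffordCS3 → k * g * g * k * iG ∈ CliffordCS3 :=
    fun hk hg => mul_mem (mul_mem (mul_mem (mul_mem hk hg) hg) hk) hi
  have hX0 : X0 ∈ CliffordCS3 := hconj hK0 hS0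
  have hX1 : X1 ∈ CliffordCS3 := hconj hK1 hS1
  have hCX01 : CX01 ∈ CliffordCS3 := hconj hK1 h01
  have hCX10 : CX10 ∈ CliffordCS3 := hconj hK0 h01
  have hCX12 : CX12 ∈ CliffordCS3 := hconj hK2 h12
  have hCX21 : CX21 ∈ CliffordCS3 := hconj hK1 h12
  have hSwap : Swap12 ∈ CliffordCS3 := mul_mem (mul_mem hCX12 hCX21) hCX12
  have h02 : CS02 ∈ CliffordCS3 := mul_mem (mul_mem hSwap h01) hSwap
  have hCCZ : CCZ ∈ CliffordCS3 :=
    mul_mem (mul_mem (mul_mem (mul_mem (mul_mem (mul_mem h01 hCX21) h01) h01) h01) hCX21) h02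
  have hCCX0 : CCX0 ∈ CliffordCS3 := mul_mem (mul_mem (mul_mem hK0 hCCZ) hK0) hi
  constructor
  · rw [K0CD, Subgroup.closure_le]
    rintro g ((rfl | rfl | rfl | rfl) | rfl | rfl | rfl | rfl | rfl | rfl | rfl | rfl)
    exacts [hK0, hX1, hCX12, hCX21, hi, hS0, hS1, hS2, h01, h12, h02, hCCZ]
  · rw [P, Subgroup.closure_le]
    rintro g (rfl | rfl | rfl | rfl | rfl | rfl)
    exacts [hCX01, hCX10, hCX12, hCX21, hCCX0, hX0]

theorem PD_le_CliffordCS3 : PD ≤ CliffordCS3 := by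
  obtain ⟨h1, h2⟩ := K0CD_le_CliffordCS3_and_P_le_CliffordCS3
  rw [← isSemidirect_PD.2.2.2.2]
  exact sup_le h2 ((D_le_K0D.trans isSemidirect_K0CD.2.1).trans h1)

end CliffordCS

end

open CliffordCS in
theorem mainTheorem3 :
    -- all of these are finite subgroups of the three-qubit Clifford+CS group
    (∀ H ∈ ([CliffordCS.Q, CliffordCS.C, CliffordCS.CQ, CliffordCS.P, CliffordCS.D,
        CliffordCS.PD, CliffordCS.QD, CliffordCS.K0D, CliffordCS.K0CD] :
          List (Subgroup CliffordCS.U8)),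
      H ≤ CliffordCS.CliffordCS3 ∧ Finite H) ∧
    -- Q, with 16 elements
    (CliffordCS.IsNormalForm CliffordCS.nfQ CliffordCS.Q ∧ Nat.card CliffordCS.Q = 16) ∧
    -- C, with 24 elements
    (CliffordCS.IsNormalForm CliffordCS.nfC CliffordCS.C ∧ Nat.card CliffordCS.C = 24) ∧
    -- CQ
    (CliffordCS.IsSemidirect CliffordCS.CQ CliffordCS.C CliffordCS.Q ∧
      CliffordCS.IsNormalForm CliffordCS.nfCQ CliffordCS.CQ) ∧
    -- P contains CQ with 105 left cosets
    (CliffordCS.CQ ≤ CliffordCS.P ∧ CliffordCS.CQ.relIndex CliffordCS.P = 105 ∧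
      (∃ V : Set CliffordCS.U8,
        CliffordCS.IsLeftCosetReps V CliffordCS.P CliffordCS.CQ) ∧
      ∀ V : Set CliffordCS.U8, CliffordCS.IsLeftCosetReps V CliffordCS.P CliffordCS.CQ →
        V.ncard = 105 ∧ CliffordCS.IsNormalForm (CliffordCS.nfP V) CliffordCS.P) ∧
    -- D
    CliffordCS.IsNormalForm CliffordCS.nfD CliffordCS.D ∧
    -- PD
    (CliffordCS.IsSemidirect CliffordCS.PD CliffordCS.P CliffordCS.D ∧
      ∀ V : Set CliffordCS.U8, CliffordCS.IsLeftCosetReps V CliffordCS.P CliffordCS.CQ →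
        CliffordCS.IsNormalForm (CliffordCS.nfPD V) CliffordCS.PD) ∧
    -- QD
    (CliffordCS.IsSemidirect CliffordCS.QD CliffordCS.Q CliffordCS.D ∧
      CliffordCS.IsNormalForm CliffordCS.nfQD CliffordCS.QD) ∧
    -- K₀D
    (CliffordCS.Q ≤ CliffordCS.K0D ∧
      CliffordCS.IsNormalForm CliffordCS.nfK0D CliffordCS.K0D) ∧
    -- K₀CD
    (CliffordCS.Q ≤ CliffordCS.K0CD ∧
      CliffordCS.IsNormalForm CliffordCS.nfK0CD CliffordCS.K0CD) := by
  obtain ⟨hK0CD, hP⟩ := K0CD_le_CliffordCS3_and_P_le_CliffordCS3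
  have hfP := finite_P
  obtain ⟨V, hV⟩ := exists_isLeftCosetReps P CQ
  have hfV : Finite V := by
    refine Set.finite_of_ncard_ne_zero ?_
    rw [hV.ncard_eq, relIndex_CQ_P]
    decide
  have hC := isSemidirect_K0CD.1.trans hK0CD
  have hK0D := isSemidirect_K0CD.2.1.trans hK0CD
  refine ⟨?_, ⟨isNormalForm_nfQ, ?_⟩, ⟨isNormalForm_nfC, ?_⟩,
    ⟨isSemidirect_CQ, isNormalForm_nfCQ⟩,
    ⟨CQ_le_P, relIndex_CQ_P, ⟨V, hV⟩,
      fun W hW => ⟨hW.ncard_eq.trans relIndex_CQ_P, isNormalForm_nfP hW⟩⟩,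
    isNormalForm_nfD, ⟨isSemidirect_PD, fun W hW => isNormalForm_nfPD hW⟩,
    ⟨isSemidirect_QD, isNormalForm_nfQD⟩, ⟨Q_le_K0D, isNormalForm_nfK0D⟩,
    ⟨Q_le_K0D.trans isSemidirect_K0CD.2.1, isNormalForm_nfK0CD⟩⟩
  · simp only [List.forall_mem_cons, List.not_mem_nil, false_imp_iff, implies_true, and_true]
    exact ⟨⟨Q_le_K0D.trans hK0D, isNormalForm_nfQ.finite⟩, ⟨hC, isNormalForm_nfC.finite⟩,
      ⟨CQ_le_P.trans hP, isNormalForm_nfCQ.finite⟩, ⟨hP, hfP⟩,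
      ⟨D_le_K0D.trans hK0D, isNormalForm_nfD.finite⟩,
      ⟨PD_le_CliffordCS3, (isNormalForm_nfPD hV).finite⟩,
      ⟨QD_le_K0D.trans hK0D, isNormalForm_nfQD.finite⟩, ⟨hK0D, isNormalForm_nfK0D.finite⟩,
      ⟨hK0CD, isNormalForm_nfK0CD.finite⟩⟩
  · rw [isNormalForm_nfQ.natCard]
    simp
  · rw [isNormalForm_nfC.natCard]
    simp
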